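/- **Setting.** Let $\mathcal V$ (variables), $\mathcal C$ (symbolic constants) and $L$ (locations) be finite sets, and let $\mathcal A=\mathcal V\cup\mathcal C\cup\mathbb N$ (disjoint union) be the set of atoms. A *difference constraint* is a formal inequality $x'\le a+c$ with $x\in\mathcal V$, $a\in\mathcal A$, $c\in\mathbb Z$. A *difference constraint program* (DCP) $\Delta\mathcal P=(L,T,l_b,l_e)$ has an entry location $l_b$, an exit location $l_e$ and a finite set $T$ of transitions $l_1\xrightarrow{u}l_2$, where $u$ is a set of difference constraints. A transition *defines* $v$ if $v'\le a+c\in u$ for some $a,c$, and *uses* $v$ if $x'\le v+c\in u$ for some $x,c$. Paths are sequences of consecutive transitions (possibly empty). $\mathcal D(l)$ is the set of variables defined at $l$: $v\in\mathcal D(l)$ iff $l\neq l_b$ and every transition with target $l$ defines $v$. $v$ is *live* at $l$ if some path from $l$ not defining $v$ leads to the source of a transition that uses $v$. $\Delta\mathcal P$ is *well-defined* if $v\in\mathcal D(l)$ whenever $v$ is live at $l$, and *deterministic* if for each transition and each $v$ there is at most one pair $(a,c)$ with $v'\le a+c\in u$. A *run* is a finite or infinite sequence $(l_b,\sigma_0)\xrightarrow{u_0}(l_1,\sigma_1)\xrightarrow{u_1}\cdots$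 along a path, with valuations $\sigma_i:\mathcal A\to\mathbb N$ such that $\sigma_i(k)=k$ for $k\in\mathbb N$, $\sigma_i(s)=\sigma_0(s)$ for $s\in\mathcal C$, and $\sigma_{i+1}(x)\le\sigma_i(a)+c$ for all $x'\le a+c\in u_i$. A *complete* run is a finite run that ends in $l_e$. Let $\sharp(\tau,\rho)$ be the number of occurrences of $\tau$ on $\rho$ and ${\downarrow}(v,\rho)$ the number of $i$ with $\sigma_i(v)>\sigma_{i+1}(v)$. * $v\in\mathcal V$ is a *local bound* for $\tau$ if $\sharp(\tau,\rho)\le{\downarrow}(v,\rho)$ on every complete run $\rho$ and if, on every infinite run on which $\tau$ occurs infinitely often, the value of $v$ decreases infinitely often. A *local bound mapping* is a map $\zeta:T\to\mathcal V\cup\{\mathbf 1\}$ such that for each $\tau$ either $\zeta(\tau)$ is a local bound for $\tau$, or $\zeta(\tau)=\mathbf 1$ and $\tau$ appears at most once on any path. * An expression over $\mathcal C\cup\mathbb Z$ (built with $+,\times,\max,\min$) is a *transition bound* for $\tau$ if $\tau$ appears only finitely often on any run and $\sharp(\tau,\rho)\le\sigma_0(\mathrm{expr})$ for every complete run $\rho$.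 It is a *variable bound* for $v$ if for every complete run with $n$ steps and all $1\le i\le n$ with $v\in\mathcal D(l_i)$ we have $\sigma_i(v)\le\sigma_0(\mathrm{expr})$. **Resets.** For $v\in\mathcal V$ let $\mathcal R(v)=\{(\tau,a,c): \tau\in T,\ v'\le a+c\text{ in }\tau,\ a\ne v\}$ and $\mathcal I(v)=\{(\tau,c):\tau\in T,\ v'\le v+c\text{ in }\tau,\ c>0\}$. A path *resets* $v$ if it contains a transition $\tau$ with $(\tau,a,c)\in\mathcal R(v)$ for some $a,c$. The *reset graph* has vertex set $\mathcal A$ and an edge $a\xrightarrow{\tau,c}v$ for each $(\tau,a,c)\in\mathcal R(v)$. A *reset path* is a path $\kappa=a_n\xrightarrow{\tau_n,c_n}a_{n-1}\cdots\xrightarrow{\tau_1,c_1}a_0$ in it with $n>0$; put $\mathrm{in}(\kappa)=a_n$, $c(\kappa)=\sum_{i=1}^n c_i$, $\mathrm{trn}(\kappa)=\{\tau_n,\dots,\tau_1\}$, $\mathrm{atm}(\kappa)=\{a_n,\dots,a_0\}$. It is *sound* if for all $1\le i<n$, $a_i$ is reset on all paths of $\Delta\mathcal P$ from the target of $\tau_1$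 to the source of $\tau_i$, and *optimal* if it is sound and not a proper suffix of a sound reset path. $\mathfrak R(v)$ is the set of optimal reset paths ending in $v$. **Algorithm.** By mutual recursion, $V\mathcal B(a)=a$ for $a\in\mathcal A\setminus\mathcal V$, and for $v\in\mathcal V$ $$V\mathcal B(v)=\mathrm{Incr}(v)+\max_{(\_,a,c)\in\mathcal R(v)}\bigl(V\mathcal B(a)+c\bigr);$$ $T\mathcal B(\tau)=1$ if $\zeta(\tau)=\mathbf 1$, and otherwise $$T\mathcal B(\tau)=\sum_{\kappa\in\mathfrak R(\zeta(\tau))}\Bigl(T\mathcal B(\mathrm{trn}(\kappa))\times\max\bigl(V\mathcal B(\mathrm{in}(\kappa))+c(\kappa),0\bigr)+\sum_{a\in\mathrm{atm}(\kappa)}\mathrm{Incr}(a)\Bigr),$$ where $T\mathcal B(\{\tau_1,\dots,\tau_n\})=\min_i T\mathcal B(\tau_i)$, $\mathrm{Incr}(v)=\sum_{(\tau,c)\in\mathcal I(v)}T\mathcal B(\tau)\times c$ for $v\in\mathcal V$, and $\mathrm{Incr}(a)=0$ for $a\in\mathcal A\setminus\mathcal V$ (empty sums are $0$, and so is the maximum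 over an empty set). A call whose recursion does not terminate has the result $\bot$. **Theorem (Soundness of Bound Algorithm with Context).** Let $\Delta\mathcal P$ be a well-defined and deterministic DCP whose reset graph is a directed acyclic graph, let $\zeta$ be a local bound mapping for $\Delta\mathcal P$, and let $v\in\mathcal V$ and $\tau\in T$. Then either $T\mathcal B(\tau)=\bot$ or $T\mathcal B(\tau)$ is a transition bound for $\tau$; and either $V\mathcal B(v)=\bot$ or $V\mathcal B(v)$ is a variable bound for $v$. -/

import Mathlib

noncomputable section

namespace DiffConstraint

/-! ### Difference constraint programs -/

/-- Atoms: variables, symbolic constants and natural numbers. -/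
inductive Atom (V C : Type*) where
  | var (v : V)
  | const (s : C)
  | num (n : ℕ)

/-- The difference constraint `lhs' ≤ rhs + off`. -/
structure DC (V C : Type*) where
  lhs : V
  rhs : Atom V C
  off : ℤ

/-- A transition `src --upd--> tgt`. -/
structure Transition (V C L : Type*) where
  src : L
  upd : Set (DC V C)
  tgt : L

/-- A difference constraint program. -/
structure DCP (V C L : Type*) where
  trans : Set (Transition V C L)
  trans_finite : trans.Finite
  entry : L
  exit : L

variable {V C L : Type*}

/-- `τ` defines `v`, i.e. it has a constraint `v' ≤ a + c`. -/
def Transition.Defines (τ : Transition V C L) (v : V) : Prop :=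
  ∃ a c, (⟨v, a, c⟩ : DC V C) ∈ τ.upd

/-- `τ` uses `v`, i.e. it has a constraint `x' ≤ v + c`. -/
def Transition.Uses (τ : Transition V C L) (v : V) : Prop :=
  ∃ x c, (⟨x, .var v, c⟩ : DC V C) ∈ τ.upd

namespace DCP

variable (P : DCP V C L)

/-- Finite paths (given by their list of transitions) between two locations;
the empty path leads from each location to itself. -/
inductive IsPath : L → List (Transition V C L) → L → Prop
  | nil (l : L) : IsPath l [] l
  | cons {τ : Transition V C L} {π : List (Transition V C L)} {l : L} :
      τ ∈ P.trans → IsPath τ.tgt π l → IsPath τ.src (τ :: π) l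

/-- `v ∈ 𝒟(l)`. -/
def DefinedAt (v : V) (l : L) : Prop :=
  l ≠ P.entry ∧ ∀ τ ∈ P.trans, τ.tgt = l → τ.Defines v

/-- `v` is live at `l`: along some path starting in `l`, `v` is used before it is redefined. -/
def LiveAt (v : V) (l : L) : Prop :=
  ∃ π, ∃ τ ∈ P.trans, P.IsPath l π τ.src ∧ (∀ t ∈ π, ¬ t.Defines v) ∧ τ.Uses v

def WellDefined : Prop :=
  ∀ v l, P.LiveAt v l → P.DefinedAt v l

def Deterministic : Prop :=
  ∀ τ ∈ P.trans, ∀ (v : V) (a : Atom V C) (c : ℤ) (b : Atom V C) (d : ℤ),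
    (⟨v, a, c⟩ : DC V C) ∈ τ.upd → (⟨v, b, d⟩ : DC V C) ∈ τ.upd → a = b ∧ c = d

/-! ### Runs -/

/-- A run with `len` steps (possibly infinitely many). Step `i < len` leads from `(loc i, val i)`
to `(loc (i + 1), val (i + 1))` by the transition `step i`; entries of the sequences beyond the
length carry no meaning. -/
structure Run where
  len : ℕ∞
  loc : ℕ → L
  step : ℕ → Transition V C L
  val : ℕ → Atom V C → ℕ
  loc_zero : loc 0 = P.entry
  step_mem : ∀ i : ℕ, (i : ℕ∞) < len → step i ∈ P.trans
  step_src : ∀ i : ℕ, (i : ℕ∞) < len → (step i).src = loc i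
  step_tgt : ∀ i : ℕ, (i : ℕ∞) < len → (step i).tgt = loc (i + 1)
  val_num : ∀ i : ℕ, (i : ℕ∞) ≤ len → ∀ n : ℕ, val i (.num n) = n
  val_const : ∀ i : ℕ, (i : ℕ∞) ≤ len → ∀ s : C, val i (.const s) = val 0 (.const s)
  val_upd : ∀ i : ℕ, (i : ℕ∞) < len → ∀ d ∈ (step i).upd,
    (val (i + 1) (.var d.lhs) : ℤ) ≤ (val i d.rhs : ℤ) + d.off

namespace Run

variable {P}

/-- The positions at which `τ` occurs on `ρ`; their number is `♯(τ, ρ)`. -/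
def occ (ρ : P.Run) (τ : Transition V C L) : Set ℕ :=
  {i | (i : ℕ∞) < ρ.len ∧ ρ.step i = τ}

/-- The positions at which the value of `v` decreases on `ρ`; their number is `↓(v, ρ)`. -/
def dec (ρ : P.Run) (v : V) : Set ℕ :=
  {i | (i : ℕ∞) < ρ.len ∧ ρ.val (i + 1) (.var v) < ρ.val i (.var v)}

/-- `ρ` is finite with `n` steps and ends in the exit location. -/
def EndsAtExit (ρ : P.Run) (n : ℕ) : Prop :=
  ρ.len = n ∧ ρ.loc n = P.exit

end Run

/-! ### Local bounds -/

/-- `v` is a local bound for `τ`. Finite runs are compared by counting; on an infinite run the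
transition may not occur infinitely often unless `v` decreases infinitely often. -/
def IsLocalBound (τ : Transition V C L) (v : V) : Prop :=
  (∀ (ρ : P.Run) (n : ℕ), ρ.EndsAtExit n → (ρ.occ τ).ncard ≤ (ρ.dec v).ncard) ∧
  (∀ ρ : P.Run, (ρ.occ τ).Infinite → (ρ.dec v).Infinite)

/-- `τ` appears at most once on any path. -/
def AtMostOnce (τ : Transition V C L) : Prop :=
  ∀ l π l', P.IsPath l π l' → ∀ i j : ℕ, π[i]? = some τ → π[j]? = some τ → i = j

end DCP

/-- The values `𝒱 ∪ {1}` of a local bound mapping. -/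
inductive LocalBound (V : Type*) where
  | one
  | var (v : V)

namespace DCP

variable (P : DCP V C L)

/-- `ζ` is a local bound mapping (its values outside the transitions of `P` are irrelevant). -/
def IsLocalBoundMapping (ζ : Transition V C L → LocalBound V) : Prop :=
  ∀ τ ∈ P.trans, (ζ τ = .one ∧ P.AtMostOnce τ) ∨ ∃ v, ζ τ = .var v ∧ P.IsLocalBound τ v

/-! ### Resets, increments and the reset graph -/

/-- The resets `ℛ(v)`. -/
def resets (v : V) : Set (Transition V C L × Atom V C × ℤ) :=
  {r | r.1 ∈ P.trans ∧ (⟨v, r.2.1, r.2.2⟩ : DC V C) ∈ r.1.upd ∧ r.2.1 ≠ .var v}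

/-- The increments `ℐ(v)`. -/
def increments (v : V) : Set (Transition V C L × ℤ) :=
  {r | r.1 ∈ P.trans ∧ (⟨v, .var v, r.2⟩ : DC V C) ∈ r.1.upd ∧ 0 < r.2}

/-- `v` is reset on the path `π`. -/
def ResetOn (v : V) (π : List (Transition V C L)) : Prop :=
  ∃ τ ∈ π, ∃ a c, (τ, a, c) ∈ P.resets v

end DCP

/-- A labelled edge `src --trn, inc--> tgt` from an atom to a variable. -/
structure ResetEdge (V C L : Type*) where
  src : Atom V C
  trn : Transition V C L
  inc : ℤ
  tgt : V

namespace DCP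

variable (P : DCP V C L)

/-- The edges of the reset graph: `a --τ,c--> v` for each reset `(τ, a, c)` of `v`. -/
def resetGraph : Set (ResetEdge V C L) :=
  {e | (e.trn, e.src, e.inc) ∈ P.resets e.tgt}

/-- The reset graph is a directed acyclic graph. -/
def ResetGraphIsDAG : Prop :=
  ∀ a : Atom V C,
    ¬ Relation.TransGen (fun x y => ∃ e ∈ P.resetGraph, e.src = x ∧ Atom.var e.tgt = y) a a

/-- A reset path `aₙ --τₙ,cₙ--> aₙ₋₁ ⋯ a₁ --τ₁,c₁--> a₀`, `n > 0`, as the list of its edges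
from the last one to the first one: the entry with index `i` is `aᵢ₊₁ --τᵢ₊₁,cᵢ₊₁--> aᵢ`. -/
def IsResetPath (κ : List (ResetEdge V C L)) : Prop :=
  κ ≠ [] ∧ (∀ e ∈ κ, e ∈ P.resetGraph) ∧
    ∀ i e f, κ[i]? = some e → κ[i + 1]? = some f → e.src = .var f.tgt

/-- For `1 ≤ i < n`, the atom `aᵢ` (the target of the edge following `--τᵢ,cᵢ-->` in the list) is
reset on all paths from the target location of `τ₁` to the source location of `τᵢ`. -/
def IsSoundResetPath (κ : List (ResetEdge V C L)) : Prop :=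
  P.IsResetPath κ ∧
    ∀ e₁, κ[0]? = some e₁ → ∀ i e f, κ[i]? = some e → κ[i + 1]? = some f →
      ∀ π, P.IsPath e₁.trn.tgt π e.trn.src → P.ResetOn f.tgt π

/-- A sound reset path that cannot be extended at its beginning to a longer sound one. -/
def IsOptimalResetPath (κ : List (ResetEdge V C L)) : Prop :=
  P.IsSoundResetPath κ ∧ ∀ μ, μ ≠ [] → ¬ P.IsSoundResetPath (κ ++ μ)

/-- The optimal reset paths ending in `v`. -/
def optimalResetPaths (v : V) : Set (List (ResetEdge V C L)) :=
  {κ | P.IsOptimalResetPath κ ∧ ∃ e, κ[0]? = some e ∧ e.tgt = v}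

end DCP

/-- The set `atm(κ)` of all atoms on `κ`. -/
def atm (κ : List (ResetEdge V C L)) : Set (Atom V C) :=
  {a | ∃ e ∈ κ, a = e.src ∨ a = .var e.tgt}

/-! ### Bound expressions -/

/-- Expressions over the symbolic constants and the integers. -/
inductive BoundExpr (C : Type*) where
  | sym (s : C)
  | int (z : ℤ)
  | add (e f : BoundExpr C)
  | mul (e f : BoundExpr C)
  | max (e f : BoundExpr C)
  | min (e f : BoundExpr C)

def BoundExpr.eval (σ : C → ℕ) : BoundExpr C → ℤ
  | .sym s => (σ s : ℤ)
  | .int z => z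
  | .add e f => e.eval σ + f.eval σ
  | .mul e f => e.eval σ * f.eval σ
  | .max e f => Max.max (e.eval σ) (f.eval σ)
  | .min e f => Min.min (e.eval σ) (f.eval σ)

namespace DCP

variable (P : DCP V C L)

/-- The value of an expression under the initial valuation of `ρ`. -/
def Run.evalInit {P : DCP V C L} (ρ : P.Run) (e : BoundExpr C) : ℤ :=
  e.eval (fun s => ρ.val 0 (.const s))

/-- `τ` appears only finitely often on any (finite or infinite) run. -/
def IsBounded (τ : Transition V C L) : Prop :=
  ∀ ρ : P.Run, (ρ.occ τ).Finite

def IsTransitionBound (τ : Transition V C L) (e : BoundExpr C) : Prop :=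
  P.IsBounded τ ∧
    ∀ (ρ : P.Run) (n : ℕ), ρ.EndsAtExit n → ((ρ.occ τ).ncard : ℤ) ≤ ρ.evalInit e

def IsVariableBound (v : V) (e : BoundExpr C) : Prop :=
  ∀ (ρ : P.Run) (n : ℕ), ρ.EndsAtExit n → ∀ i : ℕ, 1 ≤ i → i ≤ n →
    P.DefinedAt v (ρ.loc i) → (ρ.val i (.var v) : ℤ) ≤ ρ.evalInit e

end DCP

/-! ### The bound algorithm with context

Results of (recursive) calls are elements of `Option (BoundExpr C)`, where `none` is `⊥`.
All operations are strict in `⊥`. -/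

/-- Some enumeration, without repetition, of a finite set. -/
def enum {α : Type*} (s : Set α) : List α :=
  open Classical in if h : s.Finite then h.toFinset.toList else []

namespace Res

def add (x y : Option (BoundExpr C)) : Option (BoundExpr C) := Option.map₂ .add x y
def mul (x y : Option (BoundExpr C)) : Option (BoundExpr C) := Option.map₂ .mul x y
def max (x y : Option (BoundExpr C)) : Option (BoundExpr C) := Option.map₂ .max x y
def min (x y : Option (BoundExpr C)) : Option (BoundExpr C) := Option.map₂ .min x y
def int (z : ℤ) : Option (BoundExpr C) := some (.int z)

def sum : List (Option (BoundExpr C)) → Option (BoundExpr C)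
  | [] => int 0
  | x :: xs => add x (sum xs)

/-- The maximum of a list, with value `0` on the empty list. -/
def maximum : List (Option (BoundExpr C)) → Option (BoundExpr C)
  | [] => int 0
  | [x] => x
  | x :: y :: xs => max x (maximum (y :: xs))

/-- The minimum of a non-empty list. -/
def minimum : List (Option (BoundExpr C)) → Option (BoundExpr C)
  | [] => none
  | [x] => x
  | x :: y :: xs => min x (minimum (y :: xs))

end Res

/-- The results of calls to `T𝓑` and `V𝓑`. -/
structure Results (V C L : Type*) where
  tb : Transition V C L → Option (BoundExpr C)
  vb : Atom V C → Option (BoundExpr C)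

namespace DCP

variable (P : DCP V C L) (ζ : Transition V C L → LocalBound V) (f : Results V C L)

/-- `Incr(v) = ∑_{(τ,c) ∈ ℐ(v)} T𝓑(τ) × c`, and `Incr(a) = 0` if `a` is not a variable. -/
def incr : Atom V C → Option (BoundExpr C)
  | .var v => Res.sum ((enum (P.increments v)).map fun r => Res.mul (f.tb r.1) (Res.int r.2))
  | .const _ => Res.int 0
  | .num _ => Res.int 0

/-- `V𝓑(a) = a` if `a` is not a variable, and
`V𝓑(v) = Incr(v) + max_{(_,a,c) ∈ ℛ(v)} (V𝓑(a) + c)`. -/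
def vbBody : Atom V C → Option (BoundExpr C)
  | .var v => Res.add (P.incr f (.var v))
      (Res.maximum ((enum (P.resets v)).map fun r => Res.add (f.vb r.2.1) (Res.int r.2.2)))
  | .const s => some (.sym s)
  | .num n => Res.int n

/-- `T𝓑(trn(κ))`, the minimum of the transition bounds along `κ`. -/
def tbTrn (κ : List (ResetEdge V C L)) : Option (BoundExpr C) :=
  Res.minimum (κ.map fun e => f.tb e.trn)

/-- `V𝓑(in(κ))`, where `in(κ)` is the atom in which the (non-empty) path `κ` starts. -/
def vbIn (κ : List (ResetEdge V C L)) : Option (BoundExpr C) :=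
  κ.getLast?.bind fun e => f.vb e.src

/-- `T𝓑(trn(κ)) × max(V𝓑(in(κ)) + c(κ), 0) + ∑_{a ∈ atm(κ)} Incr(a)`. -/
def pathBound (κ : List (ResetEdge V C L)) : Option (BoundExpr C) :=
  Res.add
    (Res.mul (tbTrn f κ)
      (Res.max (Res.add (vbIn f κ) (Res.int (κ.map ResetEdge.inc).sum)) (Res.int 0)))
    (Res.sum ((enum (atm κ)).map fun a => P.incr f a))

/-- `T𝓑(τ) = 1` if `ζ(τ) = 1`, and otherwise the sum of `pathBound κ` over all optimal reset paths
`κ` ending in `ζ(τ)`. -/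
def tbBody (τ : Transition V C L) : Option (BoundExpr C) :=
  match ζ τ with
  | .one => Res.int 1
  | .var v => Res.sum ((enum (P.optimalResetPaths v)).map fun κ => P.pathBound f κ)

/-- The mutual recursion cut off at a given depth of nested calls, with result `⊥` for each call
below that depth. -/
def resultsAt : ℕ → Results V C L
  | 0 => ⟨fun _ => none, fun _ => none⟩
  | n + 1 => ⟨P.tbBody ζ (resultsAt n), P.vbBody (resultsAt n)⟩

/-- `T𝓑(τ)`: the result of the mutual recursion if it terminates, and `⊥` if it does not. -/
def TB (τ : Transition V C L) : Option (BoundExpr C) :=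
  open Classical in
  if h : ∃ n, (P.resultsAt ζ n).tb τ ≠ none then (P.resultsAt ζ (Nat.find h)).tb τ else none

/-- `V𝓑(a)`: the result of the mutual recursion if it terminates, and `⊥` if it does not. -/
def VB (a : Atom V C) : Option (BoundExpr C) :=
  open Classical in
  if h : ∃ n, (P.resultsAt ζ n).vb a ≠ none then (P.resultsAt ζ (Nat.find h)).vb a else none

end DCP

end DiffConstraint

end

noncomputable section

namespace DiffConstraint

variable {V C L : Type*}

/-! ### Values of results -/

/-! By induction on the recursion depth, every result other than `⊥` is a bound
(`soundResults_resultsAt`); the result of a terminating call occurs at some depth.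

Variable bounds. If `v` is defined at a location of a run, the previous step constrains `v`, either
by a reset or by `v' ≤ v + c`. In the second case `v` is used, hence live, hence defined one step
earlier. Since nothing is defined at the entry, going back reaches a last reset
(`exists_last_reset`). The value of `v` is at most the value set there plus the increments since,
which `Incr` bounds over the whole run.

Transition bounds. If `v` is a local bound for `τ`, it suffices to bound the decreases of `v`, which
are at most its initial value plus all its increases. Where `v` is not live its value may change
freely, so the local bound is applied to a modified run (`Run.lower`) in which `v` starts at `0` and
increases only at resets and increments. It remains to bound the sum of the values of `v` just after
its resets. Following each reset back through last resets, as long as the reset path found is not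
optimal, gives a trace of an optimal reset path `κ` (`exists_trace`). The value set is at most
`in(κ) + c(κ)` plus the increments gathered between the resets of the trace. Soundness of `κ` keeps
two of its traces apart (`lt_of_lt`). So they use different occurrences of each transition of `κ`,
which bounds their number by the minimum of the transition bounds, and the increments gathered by
different traces occur at different times, so `Incr` pays for each atom once
(`sum_val_add_sum_gain_le_pathBound`).

On infinite runs the same modification shows that finitely many resets and increments allow only
finitely many decreases (`isBounded_of_isLocalBound`). -/

/-- The value of a result, `0` for `⊥`. -/
def Res.value (σ : C → ℕ) (x : Option (BoundExpr C)) : ℤ := x.elim 0 (BoundExpr.eval σ)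

namespace Res

@[simp] theorem value_some (σ : C → ℕ) (e : BoundExpr C) : value σ (some e) = e.eval σ := rfl

@[simp] theorem value_int (σ : C → ℕ) (z : ℤ) : value σ (int z) = z := rfl

theorem map₂_ne_none {g : BoundExpr C → BoundExpr C → BoundExpr C} {x y : Option (BoundExpr C)} :
    Option.map₂ g x y ≠ none ↔ x ≠ none ∧ y ≠ none := by
  cases x <;> cases y <;> simp

theorem value_add {σ : C → ℕ} {x y : Option (BoundExpr C)} (h : add x y ≠ none) :
    value σ (add x y) = value σ x + value σ y := by
  cases x <;> cases y <;> simp_all [add, value, BoundExpr.eval]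

theorem value_mul {σ : C → ℕ} {x y : Option (BoundExpr C)} (h : mul x y ≠ none) :
    value σ (mul x y) = value σ x * value σ y := by
  cases x <;> cases y <;> simp_all [mul, value, BoundExpr.eval]

theorem value_max {σ : C → ℕ} {x y : Option (BoundExpr C)} (h : max x y ≠ none) :
    value σ (max x y) = Max.max (value σ x) (value σ y) := by
  cases x <;> cases y <;> simp_all [max, value, BoundExpr.eval]

theorem value_min {σ : C → ℕ} {x y : Option (BoundExpr C)} (h : min x y ≠ none) :
    value σ (min x y) = Min.min (value σ x) (value σ y) := by
  cases x <;> cases y <;> simp_all [min, value, BoundExpr.eval]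

theorem ne_none_of_sum_ne_none {l : List (Option (BoundExpr C))} (h : sum l ≠ none) :
    ∀ x ∈ l, x ≠ none := by
  induction l with
  | nil => simp
  | cons x l ih =>
    obtain ⟨hx, hl⟩ := map₂_ne_none.1 h
    simpa using ⟨hx, ih hl⟩

theorem value_sum {σ : C → ℕ} {l : List (Option (BoundExpr C))} (h : sum l ≠ none) :
    value σ (sum l) = (l.map (value σ)).sum := by
  induction l with
  | nil => simp [sum]
  | cons x l ih =>
    rw [sum, value_add h, ih (map₂_ne_none.1 h).2, List.map_cons, List.sum_cons]

theorem ne_none_of_maximum_ne_none {l : List (Option (BoundExpr C))} (h : maximum l ≠ none) :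
    ∀ x ∈ l, x ≠ none := by
  induction l using maximum.induct with
  | case1 => simp
  | case2 x => simpa [maximum] using h
  | case3 x y l ih =>
    obtain ⟨hx, hl⟩ := map₂_ne_none.1 h
    simpa using ⟨hx, by simpa using ih hl⟩

theorem value_le_value_maximum {σ : C → ℕ} {l : List (Option (BoundExpr C))}
    (h : maximum l ≠ none) : ∀ x ∈ l, value σ x ≤ value σ (maximum l) := by
  induction l using maximum.induct with
  | case1 => simp
  | case2 x => simp [maximum]
  | case3 x y l ih =>
    have hl := ih (map₂_ne_none.1 h).2
    rw [maximum, value_max h]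
    rintro z hz
    rcases List.mem_cons.1 hz with rfl | hz
    · exact le_max_left _ _
    · exact (hl z hz).trans (le_max_right _ _)

theorem ne_none_of_minimum_ne_none {l : List (Option (BoundExpr C))} (h : minimum l ≠ none) :
    ∀ x ∈ l, x ≠ none := by
  induction l using minimum.induct with
  | case1 => simp
  | case2 x => simpa [minimum] using h
  | case3 x y l ih =>
    obtain ⟨hx, hl⟩ := map₂_ne_none.1 h
    simpa using ⟨hx, by simpa using ih hl⟩

theorem le_value_minimum {σ : C → ℕ} {z : ℤ} {l : List (Option (BoundExpr C))}
    (h : minimum l ≠ none) (hz : ∀ x ∈ l, z ≤ value σ x) : z ≤ value σ (minimum l) := by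
  induction l using minimum.induct with
  | case1 => exact absurd rfl h
  | case2 x => simpa [minimum] using hz
  | case3 x y l ih =>
    rw [minimum, value_min h]
    exact le_min (hz x (by simp)) (ih (map₂_ne_none.1 h).2 fun w hw => hz w (by simp_all))

end Res

theorem mem_enum {α : Type*} {s : Set α} (hs : s.Finite) {a : α} : a ∈ enum s ↔ a ∈ s := by
  simp [enum, hs]

theorem sum_map_enum {α : Type*} {s : Set α} (hs : s.Finite) (g : α → ℤ) :
    ((enum s).map g).sum = ∑ a ∈ hs.toFinset, g a := by
  simp [enum, hs]

/-! ### Finiteness -/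

namespace DCP

variable {P : DCP V C L}

/-- Determinism makes `DC.lhs` injective on the constraints of a transition, and there are finitely
many variables. -/
theorem Deterministic.upd_finite [Finite V] (hdet : P.Deterministic) {τ : Transition V C L}
    (hτ : τ ∈ P.trans) : τ.upd.Finite := by
  refine Set.Finite.of_finite_image (f := DC.lhs) (Set.toFinite _) ?_
  rintro ⟨v, a, c⟩ h ⟨_, b, d⟩ h' rfl
  obtain ⟨rfl, rfl⟩ := hdet τ hτ v a c b d h h'
  rfl

theorem Deterministic.constraints_finite [Finite V] (hdet : P.Deterministic) :
    {x : Transition V C L × DC V C | x.1 ∈ P.trans ∧ x.2 ∈ x.1.upd}.Finite := by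
  refine (P.trans_finite.biUnion fun τ hτ =>
    (hdet.upd_finite hτ).image fun d => (τ, d)).subset ?_
  rintro ⟨τ, d⟩ ⟨hτ, hd⟩
  exact Set.mem_biUnion hτ ⟨d, hd, rfl⟩

theorem Deterministic.resets_finite [Finite V] (hdet : P.Deterministic) (v : V) :
    (P.resets v).Finite := by
  refine (hdet.constraints_finite.image fun x => (x.1, x.2.rhs, x.2.off)).subset ?_
  rintro ⟨τ, a, c⟩ ⟨hτ, hd, -⟩
  exact ⟨(τ, ⟨v, a, c⟩), ⟨hτ, hd⟩, rfl⟩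

theorem Deterministic.increments_finite [Finite V] (hdet : P.Deterministic) (v : V) :
    (P.increments v).Finite := by
  refine (hdet.constraints_finite.image fun x => (x.1, x.2.off)).subset ?_
  rintro ⟨τ, c⟩ ⟨hτ, hd, -⟩
  exact ⟨(τ, ⟨v, .var v, c⟩), ⟨hτ, hd⟩, rfl⟩

theorem Deterministic.resetGraph_finite [Finite V] (hdet : P.Deterministic) :
    P.resetGraph.Finite := by
  refine (hdet.constraints_finite.image
    fun x => (⟨x.2.rhs, x.1, x.2.off, x.2.lhs⟩ : ResetEdge V C L)).subset ?_
  rintro ⟨a, τ, c, v⟩ ⟨hτ, hd, -⟩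
  exact ⟨(τ, ⟨v, a, c⟩), ⟨hτ, hd⟩, rfl⟩

theorem atm_finite (κ : List (ResetEdge V C L)) : (atm κ).Finite := by
  refine (((List.finite_toSet κ).image ResetEdge.src).union
    ((List.finite_toSet κ).image fun e => .var e.tgt)).subset ?_
  rintro a ⟨e, he, rfl | rfl⟩
  · exact .inl ⟨e, he, rfl⟩
  · exact .inr ⟨e, he, rfl⟩

theorem IsResetPath.transGen {κ : List (ResetEdge V C L)} (h : P.IsResetPath κ) {i j : ℕ}
    (hij : i < j) (hj : j < κ.length) :
    Relation.TransGen (fun x y => ∃ e ∈ P.resetGraph, e.src = x ∧ Atom.var e.tgt = y)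
      (.var κ[j].tgt) (.var (κ[i]'(hij.trans hj)).tgt) := by
  induction j, hij using Nat.le_induction with
  | base =>
    exact .single ⟨κ[i], h.2.1 _ (List.getElem_mem _),
      h.2.2 i _ _ (List.getElem?_eq_getElem _) (List.getElem?_eq_getElem hj), rfl⟩
  | succ j hij ih =>
    refine .head ⟨κ[j], h.2.1 _ (List.getElem_mem _),
      h.2.2 j _ _ (List.getElem?_eq_getElem _) (List.getElem?_eq_getElem hj), rfl⟩ (ih _)

/-- A repeated target would close a cycle in the reset graph. -/
theorem IsResetPath.tgt_injective (hdag : P.ResetGraphIsDAG) {κ : List (ResetEdge V C L)}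
    (h : P.IsResetPath κ) {i j : ℕ} (hi : i < κ.length) (hj : j < κ.length)
    (hij : κ[i].tgt = κ[j].tgt) : i = j := by
  rcases lt_trichotomy i j with hlt | rfl | hlt
  · have := h.transGen hlt hj
    rw [hij] at this
    exact absurd this (hdag _)
  · rfl
  · have := h.transGen hlt hi
    rw [hij] at this
    exact absurd this (hdag _)

/-- Acyclicity forbids repeated edges, and there are finitely many duplicate-free lists over the
finitely many edges. -/
theorem Deterministic.optimalResetPaths_finite [Finite V] (hdet : P.Deterministic)
    (hdag : P.ResetGraphIsDAG) (v : V) : (P.optimalResetPaths v).Finite := by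
  have hfin := hdet.resetGraph_finite
  have : Finite P.resetGraph := hfin
  have hl : {κ : List (ResetEdge V C L) | κ.Nodup ∧ ∀ e ∈ κ, e ∈ P.resetGraph}.Finite := by
    have := Fintype.ofFinite P.resetGraph
    have : Finite {κ : List P.resetGraph // κ.Nodup} := inferInstance
    refine (Set.finite_range fun κ : {κ : List P.resetGraph // κ.Nodup} =>
      κ.1.map Subtype.val).subset ?_
    rintro κ ⟨hκ, hmem⟩
    exact ⟨⟨κ.attachWith _ hmem, List.Nodup.of_map Subtype.val (by simpa using hκ)⟩, by simp⟩
  refine hl.subset ?_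
  rintro κ ⟨⟨⟨hκ, -⟩, -⟩, -⟩
  refine ⟨List.nodup_iff_injective_getElem.2 ?_, hκ.2.1⟩
  rintro ⟨i, hi⟩ ⟨j, hj⟩ hij
  exact Fin.ext (hκ.tgt_injective hdag hi hj (congrArg ResetEdge.tgt hij))

end DCP

namespace DCP

/-! ### Tracing values back along a run -/

/-- The amount by which `τ` increments `w`. -/
def gain (P : DCP V C L) (w : V) (τ : Transition V C L) : ℤ :=
  open Classical in ((enum (P.increments w)).map fun r => if r.1 = τ then r.2 else 0).sum

variable {P : DCP V C L}

theorem gain_nonneg [Finite V] (hdet : P.Deterministic) (w : V) (τ : Transition V C L) :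
    0 ≤ P.gain w τ := by
  classical
  refine List.sum_nonneg fun z hz => ?_
  obtain ⟨r, hr, rfl⟩ := List.mem_map.1 hz
  have := ((mem_enum (hdet.increments_finite w)).1 hr).2.2
  split_ifs <;> omega

theorem le_gain [Finite V] (hdet : P.Deterministic) {w : V} {τ : Transition V C L} {c : ℤ}
    (hτ : τ ∈ P.trans) (h : (⟨w, .var w, c⟩ : DC V C) ∈ τ.upd) : c ≤ P.gain w τ := by
  classical
  rcases le_or_gt c 0 with hc | hc
  · exact hc.trans (gain_nonneg hdet w τ)
  have hfin := hdet.increments_finite w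
  rw [gain, sum_map_enum hfin]
  have := Finset.single_le_sum (s := hfin.toFinset) (a := (τ, c))
    (f := fun r => if r.1 = τ then r.2 else 0) (fun r hr => by
      have := ((Set.Finite.mem_toFinset _).1 hr).2.2
      split_ifs <;> omega) (by simpa using ⟨hτ, h, hc⟩)
  simpa using this

theorem LiveAt.of_uses {τ : Transition V C L} {w : V} (hτ : τ ∈ P.trans) (h : τ.Uses w) :
    P.LiveAt w τ.src :=
  ⟨[], τ, hτ, .nil _, by simp, h⟩

theorem WellDefined.not_liveAt_entry (hwd : P.WellDefined) (w : V) : ¬ P.LiveAt w P.entry :=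
  fun h => (hwd _ _ h).1 rfl

namespace Run

variable (ρ : P.Run)

theorem liveAt_of_mem_upd {p : ℕ} (hp : (p : ℕ∞) < ρ.len) {x w : V} {c : ℤ}
    (h : (⟨x, .var w, c⟩ : DC V C) ∈ (ρ.step p).upd) : P.LiveAt w (ρ.loc p) :=
  ρ.step_src p hp ▸ .of_uses (ρ.step_mem p hp) ⟨x, c, h⟩

theorem isPath {i j : ℕ} (hij : i ≤ j) (hj : (j : ℕ∞) ≤ ρ.len) :
    P.IsPath (ρ.loc i) ((List.range' i (j - i)).map ρ.step) (ρ.loc j) := by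
  induction h : j - i generalizing i with
  | zero =>
    obtain rfl : i = j := by omega
    exact .nil _
  | succ n ih =>
    have hi : (i : ℕ∞) < ρ.len := lt_of_lt_of_le (by exact_mod_cast (by omega : i < j)) hj
    rw [List.range'_succ, List.map_cons, ← ρ.step_src i hi]
    refine .cons (ρ.step_mem i hi) ?_
    rw [ρ.step_tgt i hi]
    exact ih (by omega) (by omega)

/-- A variable with a definition has been reset before, and since then it only got increments. -/
theorem exists_last_reset [Finite V] (hwd : P.WellDefined) (hdet : P.Deterministic) {w : V}
    {p : ℕ} (hp : (p : ℕ∞) ≤ ρ.len) (hw : P.DefinedAt w (ρ.loc p)) :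
    ∃ q < p, ∃ e ∈ P.resetGraph, e.trn = ρ.step q ∧ e.tgt = w ∧
      (∀ j, q < j → j < p → ∀ a c, (ρ.step j, a, c) ∉ P.resets w) ∧
      (ρ.val p (.var w) : ℤ) ≤
        ρ.val q e.src + e.inc + ∑ j ∈ Finset.Ioo q p, P.gain w (ρ.step j) := by
  induction p with
  | zero => exact absurd ρ.loc_zero hw.1
  | succ p ih =>
    have hp' : (p : ℕ∞) < ρ.len := lt_of_lt_of_le (by exact_mod_cast p.lt_succ_self) hp
    obtain ⟨a, c, hac⟩ := hw.2 _ (ρ.step_mem p hp') (ρ.step_tgt p hp')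
    have hval := ρ.val_upd p hp' _ hac
    -- A constraint `w' ≤ w + c` uses `w`, so `w` is live and hence defined one step earlier;
    -- otherwise step `p` itself is the last reset.
    by_cases ha : a = .var w
    · subst ha
      obtain ⟨q, hq, e, he, htrn, htgt, hno, hle⟩ :=
        ih hp'.le (hwd _ _ (ρ.liveAt_of_mem_upd hp' hac))
      refine ⟨q, by omega, e, he, htrn, htgt, fun j hqj hj a d hr => ?_, ?_⟩
      · rcases Nat.lt_succ_iff_lt_or_eq.1 hj with hj | rfl
        · exact hno j hqj hj a d hr
        · exact hr.2.2 (hdet _ (ρ.step_mem j hp') _ _ _ _ _ hac hr.2.1).1.symm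
      · have hc := le_gain hdet (ρ.step_mem p hp') hac
        have hI : Finset.Ioo q (p + 1) = insert p (Finset.Ioo q p) := by
          ext j; simp; omega
        rw [hI, Finset.sum_insert (by simp)]
        dsimp only at hval
        linarith
    · refine ⟨p, by omega, ⟨a, ρ.step p, c, w⟩, ⟨ρ.step_mem p hp', hac, ha⟩, rfl, rfl,
        fun j _ _ => by omega, ?_⟩
      have hI : Finset.Ioo p (p + 1) = ∅ := by ext j; simp
      simpa [hI] using hval

/-- The path `κ` lists resets on `ρ`: the one with index `k` happens in step `pos k`, and the one
with index `k + 1` is the last reset of the variable it sets before step `pos k`. -/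
structure Trace (κ : List (ResetEdge V C L)) (pos : ℕ → ℕ) : Prop where
  lt_len : ∀ k < κ.length, (pos k : ℕ∞) < ρ.len
  step_pos : ∀ k e, κ[k]? = some e → ρ.step (pos k) = e.trn
  anti : ∀ k, k + 1 < κ.length → pos (k + 1) < pos k
  not_reset : ∀ k f, κ[k + 1]? = some f → ∀ j, pos (k + 1) < j → j < pos k →
    ∀ a c, (ρ.step j, a, c) ∉ P.resets f.tgt
  val_le : ∀ k f, κ[k + 1]? = some f → (ρ.val (pos k) (.var f.tgt) : ℤ) ≤
    ρ.val (pos (k + 1)) f.src + f.inc +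
      ∑ j ∈ Finset.Ioo (pos (k + 1)) (pos k), P.gain f.tgt (ρ.step j)

end Run

/-- As `κ` is not empty, the first edge `f` of the extended path enters the soundness condition only
through its target, so any reset of the same variable may replace `g`. -/
theorem IsSoundResetPath.append_singleton {κ μ : List (ResetEdge V C L)} {g f : ResetEdge V C L}
    (hκ : κ ≠ []) (h : P.IsSoundResetPath (κ ++ g :: μ)) (hf : f ∈ P.resetGraph)
    (hgf : g.tgt = f.tgt) : P.IsSoundResetPath (κ ++ [f]) := by
  have hpos := List.length_pos_iff.2 hκ
  obtain ⟨⟨-, hmem, hcons⟩, hsound⟩ := h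
  have key : ∀ i e, (κ ++ [f])[i]? = some e →
      (i < κ.length ∧ (κ ++ g :: μ)[i]? = some e) ∨ (i = κ.length ∧ e = f) := by
    intro i e hi
    grind
  have hg : (κ ++ g :: μ)[κ.length]? = some g := by simp
  refine ⟨⟨by simp, ?_, ?_⟩, ?_⟩
  · intro e he
    rcases List.mem_append.1 he with he | he
    · exact hmem e (by simp [he])
    · rw [List.mem_singleton.1 he]; exact hf
  · intro i e e' hi hi'
    rcases key _ _ hi with ⟨hlt, hold⟩ | ⟨heq, -⟩
    · rcases key _ _ hi' with ⟨hlt', hold'⟩ | ⟨heq', rfl⟩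
      · exact hcons i e e' hold hold'
      · rw [← hgf]
        exact hcons i e g hold (heq' ▸ hg)
    · rcases key _ _ hi' with ⟨hlt', -⟩ | ⟨heq', -⟩ <;> omega
  · intro e₁ h₁ i e e' hi hi'
    rcases key _ _ h₁ with ⟨-, hold₁⟩ | ⟨h0, -⟩
    · rcases key _ _ hi with ⟨hlt, hold⟩ | ⟨heq, -⟩
      · rcases key _ _ hi' with ⟨hlt', hold'⟩ | ⟨heq', rfl⟩
        · exact hsound e₁ hold₁ i e e' hold hold'
        · rw [← hgf]
          exact hsound e₁ hold₁ i e g hold (heq' ▸ hg)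
      · rcases key _ _ hi' with ⟨hlt', -⟩ | ⟨heq', -⟩ <;> omega
    · omega

theorem IsSoundResetPath.singleton {e : ResetEdge V C L} (he : e ∈ P.resetGraph) :
    P.IsSoundResetPath [e] := by
  refine ⟨⟨by simp, by simpa using he, fun i e f _ h => by simp at h⟩,
    fun e _ i e f _ h => by simp at h⟩

namespace Run.Trace

variable {ρ : P.Run} {κ : List (ResetEdge V C L)} {pos : ℕ → ℕ}

theorem add_le (h : ρ.Trace κ pos) {k : ℕ} (hk : k < κ.length) : pos k + k ≤ pos 0 := by
  induction k with
  | zero => simp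
  | succ k ih =>
    have := h.anti k hk
    have := ih (by omega)
    omega

theorem exists_extension [Finite V] (hwd : P.WellDefined) (hdet : P.Deterministic)
    (h : ρ.Trace κ pos) (hs : P.IsSoundResetPath κ) (ho : ¬ P.IsOptimalResetPath κ) :
    ∃ f q, ρ.Trace (κ ++ [f]) (Function.update pos κ.length q) ∧
      P.IsSoundResetPath (κ ++ [f]) := by
  obtain ⟨μ, hμ, hsμ⟩ : ∃ μ, μ ≠ [] ∧ P.IsSoundResetPath (κ ++ μ) := by
    simpa [IsOptimalResetPath, hs] using ho
  obtain ⟨g, μ, rfl⟩ := List.exists_cons_of_ne_nil hμ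
  obtain ⟨m, hm⟩ := Nat.exists_eq_succ_of_ne_zero (List.length_pos_iff.2 hs.1.1).ne'
  have hlast : κ[m]? = some κ[m] := List.getElem?_eq_getElem (by omega)
  have hsrc : κ[m].src = .var g.tgt := hsμ.1.2.2 m _ _
    (by rw [List.getElem?_append_left (by omega), hlast])
    (by rw [List.getElem?_append_right (by omega)]; simp [hm])
  have hlt := h.lt_len m (by omega)
  have hused : (⟨κ[m].tgt, .var g.tgt, κ[m].inc⟩ : DC V C) ∈ (ρ.step (pos m)).upd := by
    rw [h.step_pos m _ hlast, ← hsrc]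
    exact (hs.1.2.1 _ (List.getElem_mem (by omega))).2.1
  -- The edge `g` only names the atom to trace further; the reset `f` that happens on the run may
  -- differ from it but sets the same variable.
  obtain ⟨q, hq, f, hf, htrn, htgt, hno, hle⟩ := ρ.exists_last_reset hwd hdet hlt.le
    (hwd _ _ (ρ.liveAt_of_mem_upd hlt hused))
  refine ⟨f, q, ?_, hsμ.append_singleton hs.1.1 hf htgt.symm⟩
  have key : ∀ i e, (κ ++ [f])[i]? = some e →
      (i < κ.length ∧ κ[i]? = some e) ∨ (i = κ.length ∧ e = f) := by
    intro i e hi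
    grind
  have upd : ∀ i, i < κ.length → Function.update pos κ.length q i = pos i := fun i hi =>
    Function.update_of_ne (by omega) _ _
  have upd' : Function.update pos κ.length q (m + 1) = q := by rw [← Nat.succ_eq_add_one, ← hm]; simp
  rw [← htgt] at hno hle
  constructor
  · intro k hk
    rcases lt_or_ge k κ.length with hk' | hk'
    · rw [upd k hk']
      exact h.lt_len k hk'
    · obtain rfl : k = m + 1 := by simp at hk; omega
      rw [upd']
      exact lt_trans (by exact_mod_cast hq) hlt
  · intro k e hk
    rcases key _ _ hk with ⟨hk', hk⟩ | ⟨rfl, rfl⟩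
    · rw [upd k hk']
      exact h.step_pos k e hk
    · simp [htrn]
  · intro k hk
    rw [List.length_append, List.length_singleton] at hk
    rcases lt_or_ge (k + 1) κ.length with hk' | hk'
    · rw [upd _ hk', upd k (by omega)]
      exact h.anti k hk'
    · obtain rfl : k = m := by omega
      rwa [upd', upd k (by omega)]
  · intro k e hk
    rcases key _ _ hk with ⟨hk', hk⟩ | ⟨hk', rfl⟩
    · rw [upd _ hk', upd k (by omega)]
      exact h.not_reset k e hk
    · obtain rfl : k = m := by omega
      rw [upd', upd k (by omega)]
      exact hno
  · intro k e hk
    rcases key _ _ hk with ⟨hk', hk⟩ | ⟨hk', rfl⟩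
    · rw [upd _ hk', upd k (by omega)]
      exact h.val_le k e hk
    · obtain rfl : k = m := by omega
      rw [upd', upd k (by omega)]
      exact hle

theorem exists_optimal [Finite V] (hwd : P.WellDefined) (hdet : P.Deterministic)
    (h : ρ.Trace κ pos) (hs : P.IsSoundResetPath κ) :
    ∃ κ' pos', ρ.Trace κ' pos' ∧ P.IsOptimalResetPath κ' ∧ pos' 0 = pos 0 ∧ κ'[0]? = κ[0]? := by
  -- Positions strictly decrease along a trace, so its length is at most `pos 0 + 1`; `m` bounds the
  -- number of extensions left.
  obtain ⟨m, hm⟩ : ∃ m, pos 0 + 1 ≤ κ.length + m := ⟨pos 0 + 1, by omega⟩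
  induction m generalizing κ pos with
  | zero =>
    by_cases ho : P.IsOptimalResetPath κ
    · exact ⟨κ, pos, h, ho, rfl, rfl⟩
    obtain ⟨f, q, hf, -⟩ := h.exists_extension hwd hdet hs ho
    have h0 := List.length_pos_iff.2 hs.1.1
    have := hf.add_le (k := κ.length) (by simp)
    rw [Function.update_of_ne (a := 0) (by omega)] at this
    omega
  | succ m ih =>
    by_cases ho : P.IsOptimalResetPath κ
    · exact ⟨κ, pos, h, ho, rfl, rfl⟩
    obtain ⟨f, q, hf, hsf⟩ := h.exists_extension hwd hdet hs ho
    have h0 := List.length_pos_iff.2 hs.1.1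
    have hupd : Function.update pos κ.length q 0 = pos 0 :=
      Function.update_of_ne (by omega) _ _
    obtain ⟨κ', pos', h', ho', hp', hk'⟩ := ih hf hsf (by rw [hupd]; simp; omega)
    exact ⟨κ', pos', h', ho', hp'.trans hupd, hk'.trans (List.getElem?_append_left h0)⟩

/-- Soundness of `κ` separates two occurrences of `κ` on a run. -/
theorem lt_of_lt (h : ρ.Trace κ pos) {pos' : ℕ → ℕ} (h' : ρ.Trace κ pos')
    (hs : P.IsSoundResetPath κ) (hlt : pos 0 < pos' 0) {k : ℕ} (hk : k < κ.length) :
    pos 0 < pos' k := by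
  induction k with
  | zero => exact hlt
  | succ k ih =>
    have hk' := ih (by omega)
    have hl := h.lt_len 0 (by omega)
    have hl' := h'.lt_len k (by omega)
    have h0 : κ[0]? = some κ[0] := List.getElem?_eq_getElem (by omega)
    have h1 : κ[k]? = some κ[k] := List.getElem?_eq_getElem (by omega)
    have h2 : κ[k + 1]? = some κ[k + 1] := List.getElem?_eq_getElem hk
    have hpath := ρ.isPath (Nat.succ_le_of_lt hk') hl'.le
    rw [Nat.succ_eq_add_one, ← ρ.step_tgt _ hl, ← ρ.step_src _ hl', h.step_pos 0 _ h0,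
      h'.step_pos k _ h1] at hpath
    -- Soundness gives a reset of the next atom between `pos 0` and `pos' k`. As `pos' (k + 1)` is
    -- the last such reset before `pos' k`, it cannot lie at or before `pos 0`.
    obtain ⟨τ, hτ, a, c, hr⟩ := hs.2 _ h0 k _ _ h1 h2 _ hpath
    obtain ⟨j, hj, rfl⟩ := List.mem_map.1 hτ
    rw [List.mem_range'_1] at hj
    by_contra! hle
    exact h'.not_reset k _ h2 j (by omega) (by omega) a c hr

/-- The increments between the resets with indices `k + 1` and `k`. -/
def gains (ρ : P.Run) (κ : List (ResetEdge V C L)) (pos : ℕ → ℕ) (k : ℕ) : ℤ :=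
  κ[k + 1]?.elim 0 fun f => ∑ j ∈ Finset.Ioo (pos (k + 1)) (pos k), P.gain f.tgt (ρ.step j)

/-- The inequalities `val_le` telescope along the trace. -/
theorem val_add_le (h : ρ.Trace κ pos) (hκ : P.IsResetPath κ) {k : ℕ} (hk : k < κ.length) :
    (ρ.val (pos 0) κ[0].src + κ[0].inc : ℤ) ≤ ρ.val (pos k) κ[k].src +
      ((κ.map ResetEdge.inc).take (k + 1)).sum + ∑ i ∈ Finset.range k, gains ρ κ pos i := by
  induction k with
  | zero =>
    obtain ⟨e, κ, rfl⟩ := List.exists_cons_of_ne_nil hκ.1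
    simp
  | succ k ih =>
    have h2 : κ[k + 1]? = some κ[k + 1] := List.getElem?_eq_getElem hk
    have := ih (by omega)
    have hv := h.val_le k _ h2
    rw [← hκ.2.2 k _ _ (List.getElem?_eq_getElem (by omega)) h2] at hv
    have hg : gains ρ κ pos k =
        ∑ j ∈ Finset.Ioo (pos (k + 1)) (pos k), P.gain κ[k + 1].tgt (ρ.step j) := by
      rw [gains, h2]; rfl
    rw [Finset.sum_range_succ, List.sum_take_succ _ (k + 1) (by simpa using hk), hg]
    simp only [List.getElem_map]
    linarith

end Run.Trace

theorem Run.exists_trace [Finite V] (hwd : P.WellDefined) (hdet : P.Deterministic) (ρ : P.Run)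
    {p : ℕ} (hp : (p : ℕ∞) < ρ.len) {e : ResetEdge V C L} (he : e ∈ P.resetGraph)
    (htrn : e.trn = ρ.step p) :
    ∃ κ pos, ρ.Trace κ pos ∧ P.IsOptimalResetPath κ ∧ pos 0 = p ∧ κ[0]? = some e := by
  have h : ρ.Trace [e] fun _ => p := by
    refine ⟨fun _ _ => hp, fun k f hk => ?_, fun k hk => by simp at hk,
      fun k f hk => by simp at hk, fun k f hk => by simp at hk⟩
    obtain rfl : e = f := by rcases k with _ | k <;> simp_all
    exact htrn.symm
  simpa using h.exists_optimal hwd hdet (.singleton he)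

end DCP

namespace DCP

variable {P : DCP V C L}

/-! ### Soundness of the recursive calls -/

/-- All results other than `⊥` are bounds. -/
structure SoundResults (P : DCP V C L) (f : Results V C L) : Prop where
  tb : ∀ τ ∈ P.trans, ∀ e, f.tb τ = some e → P.IsTransitionBound τ e
  vb_var : ∀ v e, f.vb (.var v) = some e → P.IsVariableBound v e
  vb_const : ∀ s e, f.vb (.const s) = some e → ∀ σ, e.eval σ = σ s
  vb_num : ∀ n e, f.vb (.num n) = some e → ∀ σ, e.eval σ = n

namespace Run

variable {ρ : P.Run} {N : ℕ}

/-- The values of the symbolic constants on `ρ`. -/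
def consts (ρ : P.Run) (s : C) : ℕ := ρ.val 0 (.const s)

theorem EndsAtExit.lt_len (h : ρ.EndsAtExit N) {p : ℕ} (hp : p < N) : (p : ℕ∞) < ρ.len := by
  rw [h.1]; exact_mod_cast hp

theorem EndsAtExit.le_len (h : ρ.EndsAtExit N) {p : ℕ} (hp : p ≤ N) : (p : ℕ∞) ≤ ρ.len := by
  rw [h.1]; exact_mod_cast hp

open Classical in
theorem EndsAtExit.occ_ncard (h : ρ.EndsAtExit N) (τ : Transition V C L) :
    (ρ.occ τ).ncard = ((Finset.range N).filter fun j => ρ.step j = τ).card := by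
  rw [← Set.ncard_coe_finset]
  congr 1
  ext j
  simp [occ, h.1]

open Classical in
theorem EndsAtExit.dec_ncard (h : ρ.EndsAtExit N) (v : V) : (ρ.dec v).ncard =
    ((Finset.range N).filter fun j => ρ.val (j + 1) (.var v) < ρ.val j (.var v)).card := by
  rw [← Set.ncard_coe_finset]
  congr 1
  ext j
  simp [dec, h.1]

end Run

namespace SoundResults

variable {f : Results V C L} {ρ : P.Run} {N : ℕ}

theorem ncard_le_value (hf : P.SoundResults f) (hN : ρ.EndsAtExit N) {τ : Transition V C L}
    (hτ : τ ∈ P.trans) (h : f.tb τ ≠ none) :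
    ((ρ.occ τ).ncard : ℤ) ≤ Res.value ρ.consts (f.tb τ) := by
  obtain ⟨e, he⟩ := Option.ne_none_iff_exists'.1 h
  rw [he]
  exact (hf.tb τ hτ e he).2 ρ N hN

theorem val_le_value (hwd : P.WellDefined) (hf : P.SoundResults f) (hN : ρ.EndsAtExit N) {q : ℕ}
    (hq : q < N) {d : DC V C} (hd : d ∈ (ρ.step q).upd) (h : f.vb d.rhs ≠ none) :
    (ρ.val q d.rhs : ℤ) ≤ Res.value ρ.consts (f.vb d.rhs) := by
  obtain ⟨x, a, c⟩ := d
  obtain ⟨e, he⟩ := Option.ne_none_iff_exists'.1 h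
  dsimp only at he ⊢
  rw [he]
  cases a with
  | var w =>
    have hw := hwd _ _ (ρ.liveAt_of_mem_upd (hN.lt_len hq) hd)
    -- Variable bounds speak only of positions from `1` on; at position `0` no variable is defined.
    have hq0 : q ≠ 0 := by rintro rfl; exact hw.1 ρ.loc_zero
    exact hf.vb_var w e he ρ N hN q (by omega) hq.le hw
  | const s =>
    rw [ρ.val_const q (hN.lt_len hq).le, Res.value_some, hf.vb_const s e he]
    rfl
  | num n => rw [ρ.val_num q (hN.lt_len hq).le, Res.value_some, hf.vb_num n e he]

theorem sum_gain_le [Finite V] (hdet : P.Deterministic) (hf : P.SoundResults f)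
    (hN : ρ.EndsAtExit N) {w : V} (h : P.incr f (.var w) ≠ none) :
    ∑ j ∈ Finset.range N, P.gain w (ρ.step j) ≤ Res.value ρ.consts (P.incr f (.var w)) := by
  classical
  have hfin := hdet.increments_finite w
  have hne := Res.ne_none_of_sum_ne_none h
  rw [incr, Res.value_sum h, List.map_map, sum_map_enum hfin]
  simp only [gain, sum_map_enum hfin]
  -- Double counting: each increment `(τ, c)` contributes `c` once per occurrence of `τ`.
  rw [Finset.sum_comm]
  refine Finset.sum_le_sum fun r hr => ?_
  have hr' := (Set.Finite.mem_toFinset _).1 hr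
  have hmul := hne _ (List.mem_map_of_mem ((mem_enum hfin).2 hr'))
  have hb := hf.ncard_le_value hN hr'.1 (Res.map₂_ne_none.1 hmul).1
  rw [Function.comp_apply, Res.value_mul hmul, Res.value_int]
  refine le_trans (le_of_eq ?_) (mul_le_mul_of_nonneg_right hb hr'.2.2.le)
  rw [hN.occ_ncard, ← Finset.sum_filter, Finset.sum_const, nsmul_eq_mul]
  simp only [eq_comm]

theorem sum_gain_nonneg [Finite V] (hdet : P.Deterministic) (s : Finset ℕ) (w : V) (ρ : P.Run) :
    0 ≤ ∑ j ∈ s, P.gain w (ρ.step j) :=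
  Finset.sum_nonneg fun _ _ => gain_nonneg hdet _ _

theorem incr_nonneg [Finite V] (hdet : P.Deterministic) (hf : P.SoundResults f)
    (hN : ρ.EndsAtExit N) {a : Atom V C} (h : P.incr f a ≠ none) :
    0 ≤ Res.value ρ.consts (P.incr f a) := by
  cases a with
  | var w => exact (sum_gain_nonneg hdet _ _ _).trans (hf.sum_gain_le hdet hN h)
  | const s => simp [incr]
  | num n => simp [incr]

theorem vbBody [Finite V] (hwd : P.WellDefined) (hdet : P.Deterministic) (hf : P.SoundResults f)
    {v : V} {e : BoundExpr C} (he : P.vbBody f (.var v) = some e) : P.IsVariableBound v e := by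
  intro ρ N hN i hi hiN hv
  have hne : P.vbBody f (.var v) ≠ none := by simp [he]
  obtain ⟨hincr, hmax⟩ := Res.map₂_ne_none.1 hne
  have hval : ρ.evalInit e = Res.value ρ.consts (P.vbBody f (.var v)) := by rw [he]; rfl
  rw [hval, DCP.vbBody, Res.value_add hne]
  obtain ⟨q, hq, g, hg, htrn, rfl, -, hle⟩ :=
    ρ.exists_last_reset hwd hdet (hN.le_len hiN) hv
  have hmem := List.mem_map_of_mem (f := fun r => Res.add (f.vb r.2.1) (Res.int r.2.2))
    ((mem_enum (hdet.resets_finite g.tgt)).2 hg)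
  have hne' := Res.ne_none_of_maximum_ne_none hmax _ hmem
  have h1 := Res.value_le_value_maximum (σ := ρ.consts) hmax _ hmem
  rw [Res.value_add hne', Res.value_int] at h1
  have h2 := hf.val_le_value hwd hN (hq.trans_le hiN) (htrn ▸ hg.2.1) (Res.map₂_ne_none.1 hne').1
  have h3 := hf.sum_gain_le hdet hN hincr
  have h4 : ∑ j ∈ Finset.Ioo q i, P.gain g.tgt (ρ.step j) ≤
      ∑ j ∈ Finset.range N, P.gain g.tgt (ρ.step j) :=
    Finset.sum_le_sum_of_subset_of_nonneg (fun j hj => by simp at hj ⊢; omega)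
      fun _ _ _ => gain_nonneg hdet _ _
  dsimp only at h1 h2
  linarith

/-- The atoms of a reset path include each variable it sets, without repetition. -/
theorem sum_incr_le_value_atm [Finite V] (hdet : P.Deterministic) (hdag : P.ResetGraphIsDAG)
    (hf : P.SoundResults f) (hN : ρ.EndsAtExit N) {κ : List (ResetEdge V C L)}
    (hκ : P.IsResetPath κ) (h : Res.sum ((enum (atm κ)).map fun a => P.incr f a) ≠ none) :
    ∑ k : Fin κ.length, Res.value ρ.consts (P.incr f (.var κ[k].tgt)) ≤
      Res.value ρ.consts (Res.sum ((enum (atm κ)).map fun a => P.incr f a)) := by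
  classical
  have hfin := atm_finite κ
  rw [Res.value_sum h, List.map_map, sum_map_enum hfin]
  have hinj : Function.Injective fun k : Fin κ.length => (Atom.var κ[k].tgt : Atom V C) := by
    intro i j hij
    exact Fin.ext (hκ.tgt_injective hdag i.2 j.2 (by simpa using hij))
  rw [← Finset.sum_image (s := Finset.univ)
    (f := fun a => Res.value ρ.consts (P.incr f a)) (fun i _ j _ hij => hinj hij)]
  refine Finset.sum_le_sum_of_subset_of_nonneg ?_ fun a ha _ => ?_
  -- The sum over `atm κ` also contains the start of `κ`; its `Incr` is nonnegative, so the extra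
  -- term does no harm.
  · intro a ha
    obtain ⟨k, -, rfl⟩ := Finset.mem_image.1 ha
    simpa using ⟨κ[k], List.getElem_mem _, .inr rfl⟩
  · exact hf.incr_nonneg hdet hN (Res.ne_none_of_sum_ne_none h _
      (List.mem_map_of_mem ((mem_enum hfin).2 (by simpa using ha))))

end SoundResults

/-! ### Summing over all traces of one reset path -/

/-- The increments of one variable, summed over all traces of one sound reset path. -/
theorem sum_gains_le [Finite V] (hdet : P.Deterministic) {ρ : P.Run} {N : ℕ}
    (hN : ρ.EndsAtExit N) {κ : List (ResetEdge V C L)} (hs : P.IsSoundResetPath κ) {s : Finset ℕ}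
    {pos : ℕ → ℕ → ℕ} (ht : ∀ p ∈ s, ρ.Trace κ (pos p)) (h0 : ∀ p ∈ s, pos p 0 = p) {k : ℕ}
    (hk : k + 1 < κ.length) :
    ∑ p ∈ s, Run.Trace.gains ρ κ (pos p) k ≤
      ∑ j ∈ Finset.range N, P.gain κ[k + 1].tgt (ρ.step j) := by
  classical
  have hg : ∀ p, Run.Trace.gains ρ κ (pos p) k =
      ∑ j ∈ Finset.Ioo (pos p (k + 1)) (pos p k), P.gain κ[k + 1].tgt (ρ.step j) := by
    intro p
    rw [Run.Trace.gains, List.getElem?_eq_getElem hk]; rfl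
  simp only [hg]
  -- The interval belonging to `p` lies below position `p`, the one belonging to `q > p` above it.
  have hdisj : ∀ p ∈ s, ∀ q ∈ s, p < q →
      Disjoint (Finset.Ioo (pos p (k + 1)) (pos p k)) (Finset.Ioo (pos q (k + 1)) (pos q k)) := by
    intro p hp q hq hpq
    have h1 := (ht p hp).lt_of_lt (ht q hq) hs (by rwa [h0 p hp, h0 q hq]) hk
    have h2 := (ht p hp).add_le (k := k) (by omega)
    rw [Finset.disjoint_left]
    intro j hj hj'
    simp only [Finset.mem_Ioo] at hj hj'
    omega
  rw [← Finset.sum_biUnion]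
  · refine Finset.sum_le_sum_of_subset_of_nonneg (fun j hj => ?_)
      fun _ _ _ => gain_nonneg hdet _ _
    obtain ⟨p, hp, hj⟩ := Finset.mem_biUnion.1 hj
    have := (ht p hp).lt_len k (by omega)
    rw [hN.1] at this
    have : pos p k < N := by exact_mod_cast this
    simp only [Finset.mem_Ioo, Finset.mem_range] at hj ⊢
    omega
  · intro p hp q hq hpq
    rcases lt_or_gt_of_ne hpq with h | h
    · exact hdisj p hp q hq h
    · exact (hdisj q hq p hp h).symm

/-- Traces of one sound path are strictly ordered at every index, so each transition of `κ` occurs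
at least once per trace. This is what permits the minimum in `tbTrn`. -/
theorem card_le_ncard_occ {ρ : P.Run} {N : ℕ}
    (hN : ρ.EndsAtExit N) {κ : List (ResetEdge V C L)} (hs : P.IsSoundResetPath κ) {s : Finset ℕ}
    {pos : ℕ → ℕ → ℕ} (ht : ∀ p ∈ s, ρ.Trace κ (pos p)) (h0 : ∀ p ∈ s, pos p 0 = p)
    {e : ResetEdge V C L} (he : e ∈ κ) : s.card ≤ (ρ.occ e.trn).ncard := by
  classical
  obtain ⟨k, hk, rfl⟩ := List.mem_iff_getElem.1 he
  rw [hN.occ_ncard]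
  have hlt : ∀ p ∈ s, ∀ q ∈ s, p < q → pos p k < pos q k := by
    intro p hp q hq hpq
    have h1 := (ht p hp).lt_of_lt (ht q hq) hs (by rwa [h0 p hp, h0 q hq]) hk
    have h2 := (ht p hp).add_le hk
    omega
  refine Finset.card_le_card_of_injOn (fun p => pos p k) (fun p hp => ?_) fun p hp q hq hpq => ?_
  · have := (ht p hp).lt_len k hk
    rw [hN.1] at this
    simpa using ⟨by exact_mod_cast this, (ht p hp).step_pos k _ (List.getElem?_eq_getElem hk)⟩
  · rcases lt_trichotomy p q with h | h | h
    · exact absurd hpq (hlt p hp q hq h).ne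
    · exact h
    · exact absurd hpq (hlt q hq p hp h).ne'

namespace SoundResults

variable {f : Results V C L} {ρ : P.Run} {N : ℕ}

/-- The bound of a sound reset path covers all values set through it. -/
theorem sum_val_add_sum_gain_le_pathBound [Finite V] (hwd : P.WellDefined)
    (hdet : P.Deterministic) (hdag : P.ResetGraphIsDAG) (hf : P.SoundResults f)
    (hN : ρ.EndsAtExit N) {κ : List (ResetEdge V C L)} (hs : P.IsSoundResetPath κ)
    {s : Finset ℕ} {pos : ℕ → ℕ → ℕ} (ht : ∀ p ∈ s, ρ.Trace κ (pos p))
    (h0 : ∀ p ∈ s, pos p 0 = p) {v : V} (hv : ∃ e, κ[0]? = some e ∧ e.tgt = v)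
    (hne : P.pathBound f κ ≠ none) :
    ∑ p ∈ s, (ρ.val (p + 1) (.var v) : ℤ) + ∑ j ∈ Finset.range N, P.gain v (ρ.step j) ≤
      Res.value ρ.consts (P.pathBound f κ) := by
  classical
  obtain ⟨e₀, he₀, rfl⟩ := hv
  obtain ⟨m, hm⟩ := Nat.exists_eq_succ_of_ne_zero (List.length_pos_iff.2 hs.1.1).ne'
  obtain ⟨hmul, hatm⟩ := Res.map₂_ne_none.1 hne
  obtain ⟨htrn, hmax⟩ := Res.map₂_ne_none.1 hmul
  have hadd := (Res.map₂_ne_none.1 hmax).1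
  have hvb := (Res.map₂_ne_none.1 hadd).1
  rw [pathBound, Res.value_add hne, Res.value_mul hmul, Res.value_max hmax, Res.value_add hadd,
    Res.value_int, Res.value_int]
  have hlast : κ.getLast? = some κ[m] := by
    have hm' : κ.length - 1 = m := by omega
    rw [List.getLast?_eq_getElem?, hm']
    exact List.getElem?_eq_getElem _
  have hin : vbIn f κ = f.vb κ[m].src := by rw [vbIn, hlast]; rfl
  rw [hin] at hvb ⊢
  obtain rfl : κ[0] = e₀ := by
    have := List.getElem?_eq_getElem (l := κ) (i := 0) (by omega)
    rw [this] at he₀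
    exact Option.some.inj he₀
  set M : ℤ := Res.value ρ.consts (f.vb κ[m].src) + (κ.map ResetEdge.inc).sum with hM
  have hp : ∀ p ∈ s, (ρ.val (p + 1) (.var κ[0].tgt) : ℤ) ≤
      max M 0 + ∑ k ∈ Finset.range m, Run.Trace.gains ρ κ (pos p) k := by
    intro p hp
    have h1 := (ht p hp).val_add_le hs.1 (k := m) (by omega)
    rw [List.take_of_length_le (by simp [hm])] at h1
    have hlt := (ht p hp).lt_len 0 (by omega)
    have hstep := (ht p hp).step_pos 0 _ he₀
    have h2 := ρ.val_upd _ hlt ⟨κ[0].tgt, κ[0].src, κ[0].inc⟩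
      (hstep ▸ (hs.1.2.1 _ (List.getElem_mem _)).2.1)
    have hltm := (ht p hp).lt_len m (by omega)
    have hstepm := (ht p hp).step_pos m _ (List.getElem?_eq_getElem (by omega))
    rw [hN.1] at hltm
    have h3 := hf.val_le_value hwd hN (q := pos p m) (by exact_mod_cast hltm)
      (d := ⟨κ[m].tgt, κ[m].src, κ[m].inc⟩)
      (hstepm ▸ (hs.1.2.1 _ (List.getElem_mem _)).2.1) hvb
    rw [h0 p hp] at h1 h2
    have := le_max_left M 0
    dsimp only at h2 h3
    linarith
  have hcard : (s.card : ℤ) ≤ Res.value ρ.consts (tbTrn f κ) := by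
    refine Res.le_value_minimum htrn fun x hx => ?_
    obtain ⟨e, he, rfl⟩ := List.mem_map.1 hx
    refine le_trans ?_ (hf.ncard_le_value hN (hs.1.2.1 e he).1
      (Res.ne_none_of_minimum_ne_none htrn _ hx))
    exact_mod_cast card_le_ncard_occ hN hs ht h0 he
  -- `Incr` of the last atom of `κ` (index `0`) pays for the increments of `v` itself; the other
  -- indices pay for the increments gathered inside the traces.
  have hincr : ∀ k (hk : k < κ.length), ∑ j ∈ Finset.range N, P.gain κ[k].tgt (ρ.step j) ≤
      Res.value ρ.consts (P.incr f (.var κ[k].tgt)) := by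
    intro k hk
    refine hf.sum_gain_le hdet hN (Res.ne_none_of_sum_ne_none hatm _ (List.mem_map_of_mem
      ((mem_enum (atm_finite κ)).2 ⟨κ[k], List.getElem_mem _, .inr rfl⟩)))
  have hsum := hf.sum_incr_le_value_atm hdet hdag hN hs.1 hatm
  have hsplit : ∑ k : Fin κ.length, Res.value ρ.consts (P.incr f (.var κ[k].tgt)) =
      Res.value ρ.consts (P.incr f (.var κ[0].tgt)) +
      ∑ k : Fin m, Res.value ρ.consts (P.incr f (.var (κ[(k : ℕ) + 1]'(by omega)).tgt)) := by
    have hcast : ∀ n (hn : n = κ.length),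
        ∑ k : Fin κ.length, Res.value ρ.consts (P.incr f (.var κ[k].tgt)) =
        ∑ k : Fin n, Res.value ρ.consts (P.incr f (.var (κ[(k : ℕ)]'(hn ▸ k.2)).tgt)) := by
      rintro n rfl; rfl
    rw [hcast (m + 1) hm.symm, Fin.sum_univ_succ]
    rfl
  have hgains : ∑ p ∈ s, ∑ k ∈ Finset.range m, Run.Trace.gains ρ κ (pos p) k ≤
      ∑ k : Fin m, Res.value ρ.consts (P.incr f (.var (κ[(k : ℕ) + 1]'(by omega)).tgt)) := by
    rw [Finset.sum_comm, Finset.sum_range]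
    exact Finset.sum_le_sum fun k _ =>
      (sum_gains_le hdet hN hs ht h0 (by omega)).trans (hincr _ _)
  -- The number of traces may be replaced by its bound only in front of a nonnegative factor, hence
  -- the maximum with `0`.
  have hmulle : (s.card : ℤ) * max M 0 ≤ Res.value ρ.consts (tbTrn f κ) * max M 0 :=
    mul_le_mul_of_nonneg_right hcard (le_max_right _ _)
  have htotal := Finset.sum_le_sum hp
  rw [Finset.sum_add_distrib, Finset.sum_const, nsmul_eq_mul] at htotal
  have := hincr 0 (by omega)
  linarith

end SoundResults

end DCP

/-! ### Counting decreases -/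

theorem card_decreases_le {g : ℕ → ℕ} {I : ℕ → ℤ} {N : ℕ}
    (hI : ∀ j < N, 0 ≤ I j) (h : ∀ j < N, (g (j + 1) : ℤ) ≤ g j + I j) :
    (((Finset.range N).filter fun j => g (j + 1) < g j).card : ℤ) ≤
      g 0 + ∑ j ∈ Finset.range N, I j := by
  -- Keeping the final value on the left makes the induction go through.
  suffices H : (((Finset.range N).filter fun j => g (j + 1) < g j).card : ℤ) + g N ≤
      g 0 + ∑ j ∈ Finset.range N, I j by
    have : (0 : ℤ) ≤ g N := Int.natCast_nonneg _
    linarith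
  induction N with
  | zero => simp
  | succ N ih =>
    have h1 := ih (fun j hj => hI j (by omega)) fun j hj => h j (by omega)
    have h2 := h N (by omega)
    have hI := hI N (by omega)
    rw [Finset.range_add_one, Finset.filter_insert, Finset.sum_insert (by simp)]
    split_ifs with hlt
    · rw [Finset.card_insert_of_notMem (by simp)]
      have h3 : (g (N + 1) : ℤ) + 1 ≤ g N := by exact_mod_cast hlt
      push_cast
      linarith
    · linarith

theorem finite_decreases {g : ℕ → ℕ} {B : Set ℕ} (hB : B.Finite)
    (h : ∀ j ∉ B, g (j + 1) ≤ g j) : {j | g (j + 1) < g j}.Finite := by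
  classical
  by_contra hinf
  -- A step in `B` increases `g` by at most the value it reaches, and no other step increases it, so
  -- at most `K` decreases are possible.
  set K : ℕ := g 0 + ∑ j ∈ hB.toFinset, g (j + 1) with hK
  obtain ⟨s, hs, hcard⟩ := Set.Infinite.exists_subset_card_eq hinf (K + 1)
  obtain ⟨N, hN⟩ := s.exists_nat_subset_range
  have h1 := card_decreases_le (g := g) (N := N)
    (I := fun j => if j ∈ hB.toFinset then (g (j + 1) : ℤ) else 0) (fun j _ => by positivity) fun j _ => by
      by_cases hj : j ∈ B
      · simp [hj]
      · simpa [hj] using h j hj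
  have h2 : s.card ≤ ((Finset.range N).filter fun j => g (j + 1) < g j).card :=
    Finset.card_le_card fun j hj => Finset.mem_filter.2 ⟨hN hj, hs hj⟩
  have h3 : (∑ j ∈ Finset.range N, if j ∈ hB.toFinset then (g (j + 1) : ℤ) else 0) ≤
      ∑ j ∈ hB.toFinset, (g (j + 1) : ℤ) := by
    rw [← Finset.sum_filter]
    exact Finset.sum_le_sum_of_subset_of_nonneg (fun j hj => (Finset.mem_filter.1 hj).2)
      fun _ _ _ => Int.natCast_nonneg _
  have h4 : (K : ℤ) = g 0 + ∑ j ∈ hB.toFinset, (g (j + 1) : ℤ) := by rw [hK]; push_cast; rfl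
  have h5 : ((K : ℤ) + 1) ≤ ((Finset.range N).filter fun j => g (j + 1) < g j).card := by
    rw [hcard] at h2
    exact_mod_cast h2
  linarith

namespace DCP

variable {P : DCP V C L}

/-! ### Lowering a variable where it is not live -/

namespace Run

open Classical in
/-- The values of `v` on `ρ`, lowered to avoid increases where `v` is not live. -/
def lowered (ρ : P.Run) (v : V) : ℕ → ℕ
  | 0 => 0
  | i + 1 => if P.LiveAt v (ρ.loc (i + 1)) then ρ.val (i + 1) (.var v)
      else min (ρ.val (i + 1) (.var v)) (lowered ρ v i)

variable (ρ : P.Run) (v : V)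

theorem lowered_le (i : ℕ) : ρ.lowered v i ≤ ρ.val i (.var v) := by
  cases i with
  | zero => exact Nat.zero_le _
  | succ i =>
    rw [lowered]
    split_ifs
    · exact le_rfl
    · exact min_le_left _ _

theorem lowered_of_liveAt (hwd : P.WellDefined) {i : ℕ} (h : P.LiveAt v (ρ.loc i)) :
    ρ.lowered v i = ρ.val i (.var v) := by
  cases i with
  | zero => exact absurd (ρ.loc_zero ▸ h) (hwd.not_liveAt_entry v)
  | succ i => rw [lowered, if_pos h]

theorem lowered_succ_le {i : ℕ} (h : ¬ P.LiveAt v (ρ.loc (i + 1))) :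
    ρ.lowered v (i + 1) ≤ ρ.lowered v i := by
  rw [lowered, if_neg h]
  exact min_le_right _ _

open Classical in
/-- The run `ρ` with the values of `v` lowered where `v` is not live. -/
def lower (hwd : P.WellDefined) : P.Run where
  __ := ρ
  val i a := if a = .var v then ρ.lowered v i else ρ.val i a
  val_num i hi n := by simpa using ρ.val_num i hi n
  val_const i hi s := by simpa using ρ.val_const i hi s
  val_upd i hi d hd := by
    have hrhs : (if d.rhs = .var v then ρ.lowered v i else ρ.val i d.rhs) = ρ.val i d.rhs := by
      split_ifs with h
      · rw [h]
        refine ρ.lowered_of_liveAt v hwd (ρ.liveAt_of_mem_upd hi (x := d.lhs) (c := d.off) ?_)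
        rwa [← h]
      · rfl
    rw [hrhs]
    refine le_trans ?_ (ρ.val_upd i hi d hd)
    split_ifs with h
    · rw [Atom.var.inj h]
      exact_mod_cast ρ.lowered_le v (i + 1)
    · exact le_rfl

theorem lower_val (hwd : P.WellDefined) (i : ℕ) : (ρ.lower v hwd).val i (.var v) = ρ.lowered v i :=
  if_pos rfl

/-- Without a reset the defining constraint has the form `v' ≤ v + c`, so `v` is live before the
step too, and at both ends the lowered value is the original one. -/
theorem lowered_succ_le_add (hwd : P.WellDefined) {i : ℕ} (hi : (i : ℕ∞) < ρ.len)
    (hr : ∀ a c, (ρ.step i, a, c) ∉ P.resets v) (hlive : P.LiveAt v (ρ.loc (i + 1))) :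
    ∃ c, (⟨v, .var v, c⟩ : DC V C) ∈ (ρ.step i).upd ∧
      (ρ.lowered v (i + 1) : ℤ) ≤ ρ.lowered v i + c := by
  obtain ⟨a, c, hac⟩ := (hwd _ _ hlive).2 _ (ρ.step_mem i hi) (ρ.step_tgt i hi)
  obtain rfl : a = .var v := by
    by_contra ha
    exact hr a c ⟨ρ.step_mem i hi, hac, ha⟩
  refine ⟨c, hac, ?_⟩
  rw [ρ.lowered_of_liveAt v hwd hlive, ρ.lowered_of_liveAt v hwd (ρ.liveAt_of_mem_upd hi hac)]
  exact ρ.val_upd i hi _ hac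

end Run

/-! ### Transition bounds from local bounds -/

theorem AtMostOnce.occ_subsingleton {τ : Transition V C L} (h : P.AtMostOnce τ) (ρ : P.Run) :
    (ρ.occ τ).Subsingleton := by
  have key : ∀ i ∈ ρ.occ τ, ∀ j ∈ ρ.occ τ, i < j → False := by
    intro i hi j hj hij
    have hpath := ρ.isPath (i := i) (j := j + 1) (by omega) (by
      exact_mod_cast Order.add_one_le_of_lt hj.1)
    have := h _ _ _ hpath 0 (j - i)
      (by rw [List.getElem?_map, List.getElem?_range' (by omega)]; simp [hi.2])
      (by
        rw [List.getElem?_map, List.getElem?_range' (by omega)]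
        simp [Nat.add_sub_cancel' hij.le, hj.2])
    omega
  intro i hi j hj
  rcases lt_trichotomy i j with h | h | h
  · exact (key i hi j hj h).elim
  · exact h
  · exact (key j hj i hi h).elim

/-- A reset in a run belongs to an optimal reset path of which a trace ends there. -/
theorem Run.exists_optimal_trace [Finite V] (hwd : P.WellDefined) (hdet : P.Deterministic)
    (ρ : P.Run) {p : ℕ} (hp : (p : ℕ∞) < ρ.len) {v : V}
    (h : ∃ a c, (ρ.step p, a, c) ∈ P.resets v) :
    ∃ κ pos, ρ.Trace κ pos ∧ pos 0 = p ∧ κ ∈ P.optimalResetPaths v ∧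
      ∃ e ∈ κ, e.trn = ρ.step p := by
  obtain ⟨a, c, hr⟩ := h
  obtain ⟨κ, pos, ht, ho, h0, he⟩ :=
    ρ.exists_trace hwd hdet hp (e := ⟨a, ρ.step p, c, v⟩) hr rfl
  exact ⟨κ, pos, ht, h0, ⟨ho, _, he, rfl⟩, _, List.mem_of_getElem? he, rfl⟩

theorem Run.exists_reset_of_liveAt [Finite V] (hwd : P.WellDefined) (hdet : P.Deterministic)
    (ρ : P.Run) {p : ℕ} (hp : (p : ℕ∞) ≤ ρ.len) {v : V} (h : P.LiveAt v (ρ.loc p)) :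
    ∃ q < p, ∃ a c, (ρ.step q, a, c) ∈ P.resets v := by
  obtain ⟨q, hq, e, he, htrn, rfl, -⟩ := ρ.exists_last_reset hwd hdet hp (hwd _ _ h)
  exact ⟨q, hq, e.src, e.inc, htrn ▸ he⟩

namespace SoundResults

variable {f : Results V C L}

theorem isBounded_of_isLocalBound [Finite V] (hwd : P.WellDefined) (hdet : P.Deterministic)
    (hdag : P.ResetGraphIsDAG) (hf : P.SoundResults f) {τ : Transition V C L} {v : V}
    (hb : P.IsLocalBound τ v)
    (hne : Res.sum ((enum (P.optimalResetPaths v)).map fun κ => P.pathBound f κ) ≠ none) :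
    P.IsBounded τ := by
  intro ρ
  have hopt := hdet.optimalResetPaths_finite hdag v
  have hbounded : ∀ t ∈ P.trans, f.tb t ≠ none → (ρ.occ t).Finite := fun t ht h => by
    obtain ⟨e, he⟩ := Option.ne_none_iff_exists'.1 h
    exact (hf.tb t ht e he).1 ρ
  have hpath : ∀ κ ∈ P.optimalResetPaths v, P.pathBound f κ ≠ none := fun κ hκ =>
    Res.ne_none_of_sum_ne_none hne _ (List.mem_map_of_mem ((mem_enum hopt).2 hκ))
  set R : Set ℕ := {p | (p : ℕ∞) < ρ.len ∧ ∃ a c, (ρ.step p, a, c) ∈ P.resets v} with hRdef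
  have hR : R.Finite := by
    have hfin : (⋃ κ ∈ P.optimalResetPaths v, ⋃ e ∈ {e | e ∈ κ}, ρ.occ e.trn).Finite := by
      refine hopt.biUnion fun κ hκ => (List.finite_toSet κ).biUnion fun e he => ?_
      have htrn := (Res.map₂_ne_none.1 (Res.map₂_ne_none.1 (hpath κ hκ)).1).1
      exact hbounded _ (hκ.1.1.1.2.1 e he).1
        (Res.ne_none_of_minimum_ne_none htrn _ (List.mem_map_of_mem he))
    refine hfin.subset fun p hp => ?_
    obtain ⟨κ, pos, -, -, hκ, e, he, htrn⟩ := ρ.exists_optimal_trace hwd hdet hp.1 hp.2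
    exact Set.mem_biUnion hκ (Set.mem_biUnion he ⟨hp.1, htrn.symm⟩)
  set J : Set ℕ := {p | (p : ℕ∞) < ρ.len ∧ ∃ c, 0 < c ∧
    (⟨v, .var v, c⟩ : DC V C) ∈ (ρ.step p).upd} with hJdef
  have hJ : J.Finite := by
    have hfin : (⋃ r ∈ {r ∈ P.increments v | f.tb r.1 ≠ none}, ρ.occ r.1).Finite :=
      ((hdet.increments_finite v).subset fun r hr => hr.1).biUnion
        fun r hr => hbounded _ hr.1.1 hr.2
    refine hfin.subset fun p hp => ?_
    obtain ⟨hp, c, hc, hupd⟩ := hp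
    have hmem : (ρ.step p, c) ∈ P.increments v := ⟨ρ.step_mem p hp, hupd, hc⟩
    -- An incremented variable is live, hence was reset before. So some optimal path ends in `v`,
    -- `Incr(v)` is part of its bound, and the incrementing transition has a result other than `⊥`.
    obtain ⟨q, hq, hr⟩ :=
      ρ.exists_reset_of_liveAt hwd hdet hp.le (ρ.liveAt_of_mem_upd hp hupd)
    obtain ⟨κ, -, -, -, hκ, -⟩ :=
      ρ.exists_optimal_trace hwd hdet (lt_trans (by exact_mod_cast hq) hp) hr
    obtain ⟨e, he, rfl⟩ := hκ.2
    have hincr := Res.ne_none_of_sum_ne_none (Res.map₂_ne_none.1 (hpath κ hκ)).2 _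
      (List.mem_map_of_mem ((mem_enum (atm_finite κ)).2
        ⟨e, List.mem_of_getElem? he, .inr rfl⟩))
    have hmul := Res.ne_none_of_sum_ne_none hincr _
      (List.mem_map_of_mem ((mem_enum (hdet.increments_finite _)).2 hmem))
    exact Set.mem_biUnion (x := (ρ.step p, c)) ⟨hmem, (Res.map₂_ne_none.1 hmul).1⟩ ⟨hp, rfl⟩
  by_contra hinf
  refine hb.2 (ρ.lower v hwd) hinf ?_
  rcases eq_or_ne ρ.len ⊤ with htop | htop
  · refine (finite_decreases (g := ρ.lowered v) (hR.union hJ) fun i hi => ?_).subset ?_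
    · have hilt : (i : ℕ∞) < ρ.len := htop ▸ ENat.natCast_lt_top i
      by_cases hlive : P.LiveAt v (ρ.loc (i + 1))
      · obtain ⟨c, hc, hle⟩ := ρ.lowered_succ_le_add v hwd hilt
          (fun a c hr => hi (.inl ⟨hilt, a, c, hr⟩)) hlive
        have : c ≤ 0 := by
          by_contra! hpos
          exact hi (.inr ⟨hilt, c, hpos, hc⟩)
        omega
      · exact ρ.lowered_succ_le v hlive
    · rintro i ⟨-, hi⟩
      simpa only [ρ.lower_val, Set.mem_ofPred_eq] using hi
  · obtain ⟨n, hn⟩ := ENat.ne_top_iff_exists.1 htop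
    refine (Set.finite_lt_nat n).subset fun i hi => ?_
    have hlt : (i : ℕ∞) < ρ.len := hi.1
    rw [← hn] at hlt
    exact_mod_cast hlt

theorem ncard_occ_le_of_isLocalBound [Finite V] (hwd : P.WellDefined) (hdet : P.Deterministic)
    (hdag : P.ResetGraphIsDAG) (hf : P.SoundResults f) {τ : Transition V C L} {v : V}
    (hb : P.IsLocalBound τ v)
    (hne : Res.sum ((enum (P.optimalResetPaths v)).map fun κ => P.pathBound f κ) ≠ none)
    {ρ : P.Run} {N : ℕ} (hN : ρ.EndsAtExit N) :
    ((ρ.occ τ).ncard : ℤ) ≤ Res.value ρ.consts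
      (Res.sum ((enum (P.optimalResetPaths v)).map fun κ => P.pathBound f κ)) := by
  classical
  have hopt := hdet.optimalResetPaths_finite hdag v
  have hN' : (ρ.lower v hwd).EndsAtExit N := hN
  set S : Finset ℕ :=
    (Finset.range N).filter fun p => ∃ a c, (ρ.step p, a, c) ∈ P.resets v with hS
  set G : ℤ := ∑ j ∈ Finset.range N, P.gain v (ρ.step j) with hG
  have hG0 : 0 ≤ G := sum_gain_nonneg hdet _ _ _
  -- Without any reset `v` is never live and its lowered value never rises. The gains must then be
  -- dropped, since there may be no optimal path whose bound contains `Incr(v)`.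
  have hocc : ((ρ.occ τ).ncard : ℤ) ≤ ∑ j ∈ Finset.range N,
      ((if j ∈ S then (ρ.val (j + 1) (.var v) : ℤ) else 0) +
        if S.Nonempty then P.gain v (ρ.step j) else 0) := by
    have h1 : (ρ.occ τ).ncard ≤ _ := hb.1 (ρ.lower v hwd) N hN'
    rw [hN'.dec_ncard] at h1
    simp only [ρ.lower_val] at h1
    have hgain : ∀ j, (0 : ℤ) ≤ if S.Nonempty then P.gain v (ρ.step j) else 0 := fun j => by
      split_ifs
      exacts [gain_nonneg hdet _ _, le_rfl]
    have h2 := card_decreases_le (g := ρ.lowered v) (N := N)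
      (I := fun j => (if j ∈ S then (ρ.val (j + 1) (.var v) : ℤ) else 0) +
        if S.Nonempty then P.gain v (ρ.step j) else 0)
      (fun j _ => add_nonneg (by positivity) (hgain j)) fun j hj => ?_
    · rw [Run.lowered, Nat.cast_zero, zero_add] at h2
      exact le_trans (by exact_mod_cast h1) h2
    have hlt := hN.lt_len hj
    have hgain := hgain j
    by_cases hjS : j ∈ S
    · rw [if_pos hjS]
      have : (ρ.lowered v (j + 1) : ℤ) ≤ ρ.val (j + 1) (.var v) := by
        exact_mod_cast ρ.lowered_le v (j + 1)
      omega
    · rw [if_neg hjS]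
      by_cases hlive : P.LiveAt v (ρ.loc (j + 1))
      · obtain ⟨c, hc, hle⟩ := ρ.lowered_succ_le_add v hwd hlt
          (fun a c hr => hjS (by simpa [hS, hj] using ⟨a, c, hr⟩)) hlive
        obtain ⟨q, hq, hr⟩ := ρ.exists_reset_of_liveAt hwd hdet (hN.le_len hj) hlive
        rw [if_pos ⟨q, by simpa [hS] using ⟨by omega, hr⟩⟩]
        have := le_gain hdet (ρ.step_mem j hlt) hc
        linarith
      · have : (ρ.lowered v (j + 1) : ℤ) ≤ ρ.lowered v j := by
          exact_mod_cast ρ.lowered_succ_le v hlive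
        omega
  have hsplit : ∑ j ∈ Finset.range N, ((if j ∈ S then (ρ.val (j + 1) (.var v) : ℤ) else 0) +
      if S.Nonempty then P.gain v (ρ.step j) else 0) =
      ∑ p ∈ S, (ρ.val (p + 1) (.var v) : ℤ) + if S.Nonempty then G else 0 := by
    have hfilter : (Finset.range N).filter (· ∈ S) = S := by
      ext j
      simp only [hS, Finset.mem_filter]
      tauto
    rw [Finset.sum_add_distrib, ← Finset.sum_filter, hfilter]
    split_ifs <;> simp [hG]
  have htrace : ∀ p, ∃ κ pos, p ∈ S → ρ.Trace κ pos ∧ pos 0 = p ∧ κ ∈ P.optimalResetPaths v := by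
    intro p
    by_cases hp : p ∈ S
    · obtain ⟨hpN, hr⟩ := Finset.mem_filter.1 hp
      obtain ⟨κ, pos, ht, h0, hκ, -⟩ :=
        ρ.exists_optimal_trace hwd hdet (hN.lt_len (Finset.mem_range.1 hpN)) hr
      exact ⟨κ, pos, fun _ => ⟨ht, h0, hκ⟩⟩
    · exact ⟨[], id, fun h => absurd h hp⟩
  choose K pos hK using htrace
  have hmaps : ∀ p ∈ S, K p ∈ hopt.toFinset := fun p hp => by simpa using (hK p hp).2.2
  -- The resets are grouped by their optimal path. Every path bound contains room for `G`, though
  -- one copy suffices.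
  have hle : ∑ κ ∈ hopt.toFinset, (∑ p ∈ S.filter fun p => K p = κ,
      (ρ.val (p + 1) (.var v) : ℤ) + G) ≤ Res.value ρ.consts
      (Res.sum ((enum (P.optimalResetPaths v)).map fun κ => P.pathBound f κ)) := by
    rw [Res.value_sum hne, List.map_map, sum_map_enum hopt]
    refine Finset.sum_le_sum fun κ hκ => ?_
    have hκ' := (Set.Finite.mem_toFinset _).1 hκ
    refine hf.sum_val_add_sum_gain_le_pathBound hwd hdet hdag hN hκ'.1.1 (pos := pos)
      (fun p hp => ?_) (fun p hp => (hK p (Finset.mem_filter.1 hp).1).2.1) hκ'.2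
      (Res.ne_none_of_sum_ne_none hne _ (List.mem_map_of_mem ((mem_enum hopt).2 hκ')))
    obtain ⟨hpS, rfl⟩ := Finset.mem_filter.1 hp
    exact (hK p hpS).1
  rw [Finset.sum_add_distrib, Finset.sum_fiberwise_of_maps_to hmaps] at hle
  have hGle : (if S.Nonempty then G else 0) ≤ ∑ κ ∈ hopt.toFinset, G := by
    split_ifs with h
    · obtain ⟨p, hp⟩ := h
      exact Finset.single_le_sum (f := fun _ => G) (fun _ _ => hG0) (hmaps p hp)
    · exact Finset.sum_nonneg fun _ _ => hG0
  linarith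

theorem tbBody [Finite V] (hwd : P.WellDefined) (hdet : P.Deterministic)
    (hdag : P.ResetGraphIsDAG) (hf : P.SoundResults f) {ζ : Transition V C L → LocalBound V}
    (hζ : P.IsLocalBoundMapping ζ) {τ : Transition V C L} (hτ : τ ∈ P.trans) {e : BoundExpr C}
    (he : P.tbBody ζ f τ = some e) : P.IsTransitionBound τ e := by
  rcases hζ τ hτ with ⟨h1, honce⟩ | ⟨v, hv, hb⟩
  · rw [DCP.tbBody, h1] at he
    obtain rfl : .int 1 = e := Option.some.inj he
    refine ⟨fun ρ => (honce.occ_subsingleton ρ).finite, fun ρ n _ => ?_⟩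
    have := (Set.ncard_le_one (honce.occ_subsingleton ρ).finite).2 (honce.occ_subsingleton ρ)
    simpa [Run.evalInit, BoundExpr.eval] using this
  · rw [DCP.tbBody, hv] at he
    dsimp only at he
    have hne : Res.sum ((enum (P.optimalResetPaths v)).map fun κ => P.pathBound f κ) ≠ none := by
      simp [he]
    refine ⟨hf.isBounded_of_isLocalBound hwd hdet hdag hb hne, fun ρ n hn => ?_⟩
    have := hf.ncard_occ_le_of_isLocalBound hwd hdet hdag hb hne hn
    rwa [he] at this

end SoundResults

theorem soundResults_resultsAt [Finite V] (hwd : P.WellDefined) (hdet : P.Deterministic)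
    (hdag : P.ResetGraphIsDAG) {ζ : Transition V C L → LocalBound V}
    (hζ : P.IsLocalBoundMapping ζ) (n : ℕ) : P.SoundResults (P.resultsAt ζ n) := by
  induction n with
  | zero => constructor <;> simp [resultsAt]
  | succ n ih =>
    refine ⟨fun τ hτ e he => ih.tbBody hwd hdet hdag hζ hτ he,
      fun v e he => ih.vbBody hwd hdet he, fun s e he σ => ?_, fun m e he σ => ?_⟩
    · obtain rfl : .sym s = e := Option.some.inj he
      rfl
    · obtain rfl : .int m = e := Option.some.inj he
      rfl

end DCP

end DiffConstraint

end

theorem mainTheorem2 {V C L : Type*} [Finite V] [Finite C] [Finite L]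
    (P : DiffConstraint.DCP V C L) (hwd : P.WellDefined) (hdet : P.Deterministic)
    (hdag : P.ResetGraphIsDAG)
    (ζ : DiffConstraint.Transition V C L → DiffConstraint.LocalBound V)
    (hζ : P.IsLocalBoundMapping ζ)
    (v : V) (τ : DiffConstraint.Transition V C L) (hτ : τ ∈ P.trans) :
    (P.TB ζ τ = none ∨ ∃ e, P.TB ζ τ = some e ∧ P.IsTransitionBound τ e) ∧
    (P.VB ζ (.var v) = none ∨ ∃ e, P.VB ζ (.var v) = some e ∧ P.IsVariableBound v e) := by
  -- Soundness at every depth covers the least depth with a result other than `⊥`; results at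
  -- different depths need not be compared.
  have hsound := DiffConstraint.DCP.soundResults_resultsAt hwd hdet hdag hζ
  constructor
  · rw [DiffConstraint.DCP.TB]
    split_ifs with h
    · obtain ⟨e, he⟩ := Option.ne_none_iff_exists'.1 (Nat.find_spec h)
      exact .inr ⟨e, he, (hsound _).tb τ hτ e he⟩
    · exact .inl rfl
  · rw [DiffConstraint.DCP.VB]
    split_ifs with h
    · obtain ⟨e, he⟩ := Option.ne_none_iff_exists'.1 (Nat.find_spec h)
      exact .inr ⟨e, he, (hsound _).vb_var v e he⟩
    · exact .inl rfl
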